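/- Let $V$ be a Euclidean space with inner product $(\cdot,\cdot)$ and let $\Phi\subset V$ be an irreducible (reduced) crystallographic root system spanning $V$, with simple system $\Delta$, positive roots $\Phi^+$ and coroots $\alpha^\vee=2\alpha/(\alpha,\alpha)$, the inner product being scaled so that short roots have norm $1$. Let $h(\theta^\vee)$ be the height of $\theta^\vee$ with respect to $\Delta^\vee$. A vector $\lambda=(\lambda_\alpha)_{\alpha\in\Phi^+}\in\mathbb Z^{\Phi^+}$ is called *admitted* if $0\le\lambda_\alpha\le h(\alpha^\vee)-1$ for all $\alpha\in\Phi^+$ and, for all $\alpha,\beta\in\Phi^+$ with $\alpha+\beta\in\Phi^+$, $$\|\alpha\|^2\lambda_\alpha+\|\beta\|^2\lambda_\beta+1\le\|\alpha+\beta\|^2(\lambda_{\alpha+\beta}+1)\le\|\alpha\|^2\lambda_\alpha+\|\beta\|^2\lambda_\beta+\|\alpha\|^2+\|\beta\|^2+\|\alpha+\beta\|^2-1 .$$ Admitted vectors are ordered componentwise, and $\lambda\lessdot\gamma$ means that $\gamma$ covers $\lambda$ in the poset of admitted vectors. For $\theta\in\Phi^+$ with $\theta^\vee=\sum_{\delta\in\Delta}c_\delta\,\delta^\vee$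 put $P_\theta=\sum_{\delta\in\Delta}c_\delta X_\delta$, and let $X[\lambda]\subset\mathbb R^{\Phi^+}$ be the zero locus of the ideal generated by the polynomials $P_\theta+\lambda_\theta-X_\theta$ $(\theta\in\Phi^+)$. For $\alpha\in\Phi^+$ let $s_\alpha$ be the reflection of $V$ in $\alpha^\perp$ and let $F(s_\alpha)$ be the affine map of $\mathbb R^{\Phi^+}$ given by $$(F(s_\alpha)x)_\theta=\begin{cases}x_{s_\alpha(\theta)}&\text{if }s_\alpha(\theta)\in\Phi^+,\\-x_{-s_\alpha(\theta)}-1&\text{if }-s_\alpha(\theta)\in\Phi^+.\end{cases}$$ The $\Phi^+$-action of $s_\alpha$ on admitted vectors is defined by $s_\alpha\diamond\lambda=\gamma$ if and only if $F(s_\alpha)(X[\lambda])=X[\gamma]$. Let $H_{\alpha,k}=\{x\in V: (x,\alpha^\vee)=k\}$ and $H_{\alpha,k}^1=\{x\in V: k<(x,\alpha^\vee)<k+1\}$; alcoves are the connected components of $V\setminus\bigcup_{\alpha\in\Phi^+,k\in\mathbb Z}H_{\alpha,k}$. Let $P_{\mathcal H}=\bigcap_{\alpha\in\Delta}H_{\alpha,0}^1$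 and $A_\lambda=\bigcap_{\alpha\in\Phi^+}H^1_{\alpha,\lambda_\alpha}$. **Proposition.** Let $\lambda$ and $\gamma$ be admitted vectors. (1) $\lambda\lessdot\gamma$ if and only if there is a unique $\alpha\in\Phi^+$ such that $s_\alpha\diamond\lambda=\gamma$, $\gamma_\alpha=\lambda_\alpha+1$, and $\gamma_\beta=\lambda_\beta$ for all $\beta\in\Phi^+\setminus\{\alpha\}$. (2) Geometrically: the map $\mu\mapsto A_\mu$ is a bijection from the admitted vectors onto the alcoves contained in $P_{\mathcal H}$, and $\lambda\lessdot\gamma$ if and only if $A_\lambda$ and $A_\gamma$ are adjacent across one wall, with $A_\gamma$ on the upper side of it, i.e. there are $\alpha\in\Phi^+$ and $k\in\mathbb Z$ such that $\overline{A_\lambda}\cap\overline{A_\gamma}$ affinely spans $H_{\alpha,k}$, $(x,\alpha^\vee)<k$ on $A_\lambda$ and $(x,\alpha^\vee)>k$ on $A_\gamma$. -/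

import Mathlib

open Set

namespace ShiVariety

variable {ι V : Type*} [NormedAddCommGroup V] [InnerProductSpace ℝ V]
  {P : RootPairing ι ℝ V V}

/-- The standing conventions on a root system `Φ` in a Euclidean space `V`: coroots are vectors of
`V`, paired with roots by the inner product, `α^∨ = 2 α / (α, α)`, and the inner product is scaled
so that the short roots have norm `1`. -/
structure IsEuclideanNormalized (P : RootPairing ι ℝ V V) : Prop where
  toLinearMap_eq : ∀ x y : V, P.toLinearMap x y = inner ℝ x y
  coroot_eq : ∀ i, P.coroot i = (2 / inner ℝ (P.root i) (P.root i)) • P.root i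
  one_le_norm : ∀ i, 1 ≤ ‖P.root i‖
  exists_norm_eq_one : ∃ i, ‖P.root i‖ = 1

/-- (Indices of) the positive roots `Φ⁺`. -/
abbrev PosRoot (b : P.Base) : Type _ := {i : ι // b.IsPos i}

noncomputable instance [Finite ι] (b : P.Base) : Fintype (PosRoot b) := Fintype.ofFinite _

/-- A simple root, as a positive root. -/
def simplePos (b : P.Base) (j : b.support) : PosRoot b :=
  ⟨j, RootPairing.Base.isPos_of_mem_support j.2⟩

/-- The height `h(α^∨)` of a coroot with respect to the simple coroots. -/
noncomputable def corootHeight (b : P.Base) (i : ι) : ℤ := b.flip.height i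

/-- Boundary conditions: `0 ≤ v_α ≤ h(α^∨) - 1` for every positive root `α`. -/
def IsAdmissible (b : P.Base) (v : PosRoot b → ℤ) : Prop :=
  ∀ a : PosRoot b, v a ∈ Icc 0 (corootHeight b a - 1)

/-- Shi's system of inequalities `S[W_a]`. -/
def ShiSystem (b : P.Base) (v : PosRoot b → ℤ) : Prop :=
  ∀ a c d : PosRoot b, P.root d = P.root a + P.root c →
    ‖P.root a‖ ^ 2 * v a + ‖P.root c‖ ^ 2 * v c + 1 ≤ ‖P.root d‖ ^ 2 * (v d + 1) ∧
    ‖P.root d‖ ^ 2 * (v d + 1) ≤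
      ‖P.root a‖ ^ 2 * v a + ‖P.root c‖ ^ 2 * v c
        + ‖P.root a‖ ^ 2 + ‖P.root c‖ ^ 2 + ‖P.root d‖ ^ 2 - 1

/-- A vector is admitted if it is admissible and satisfies Shi's system. -/
def IsAdmitted (b : P.Base) (v : PosRoot b → ℤ) : Prop :=
  IsAdmissible b v ∧ ShiSystem b v

/-- Admitted vectors, with the componentwise order. -/
abbrev AdmittedVector (b : P.Base) : Type _ := {v : PosRoot b → ℤ // IsAdmitted b v}

/-- The polynomial `P_θ[c] = P_θ + c - X_θ`, where `P_θ = ∑ c_j X_{α_j}` is the linear form whose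
coefficients are the coordinates of `θ^∨` on the simple coroots. -/
noncomputable def shiPoly (b : P.Base) [P.IsRootSystem] (θ : PosRoot b) (c : ℤ) :
    MvPolynomial (PosRoot b) ℝ :=
  ∑ j : b.support, MvPolynomial.C (b.toCoweightBasis.repr (P.coroot θ) j) *
      MvPolynomial.X (simplePos b j)
    + MvPolynomial.C (c : ℝ) - MvPolynomial.X θ

/-- The component `X_{W_a}[v]` of the Shi variety: the zero locus of the ideal `J_{W_a}[v]`
generated by the `P_θ[v_θ]`, a subset of `ℝ^{Φ⁺}`. -/
def component (b : P.Base) [P.IsRootSystem] (v : PosRoot b → ℤ) : Set (PosRoot b → ℝ) :=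
  MvPolynomial.zeroLocus ℝ (Ideal.span (range fun θ : PosRoot b => shiPoly b θ (v θ)))

theorem mem_component (b : P.Base) [P.IsRootSystem] (v : PosRoot b → ℤ) (x : PosRoot b → ℝ) :
    x ∈ component b v ↔ ∀ θ : PosRoot b,
      x θ = ∑ j : b.support, b.toCoweightBasis.repr (P.coroot θ) j * x (simplePos b j) + v θ := by
  rw [component, MvPolynomial.zeroLocus_span]
  simp only [mem_ofPred_eq, forall_mem_range, shiPoly, map_sub, map_add, map_sum, map_mul,
    MvPolynomial.aeval_X, MvPolynomial.aeval_C, Algebra.algebraMap_self, RingHom.id_apply]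
  exact forall_congr' fun θ => ⟨fun h => by linarith, fun h => by linarith⟩

/-- An admissible vector is determined by its component, so that the vector `w ⋄ v` is unique. -/
theorem component_injective (b : P.Base) [P.IsRootSystem] {v u : PosRoot b → ℤ}
    (hv : IsAdmissible b v) (h : component b v = component b u) : v = u := by
  have h0 : ∀ j : b.support, v (simplePos b j) = 0 := fun j => by
    have h1 := hv (simplePos b j)
    have h2 : corootHeight b (simplePos b j : ι) = 1 :=
      RootPairing.Base.height_one_of_mem_support (b := b.flip) (i := (j : ι)) j.2
    rw [h2] at h1
    simpa [le_antisymm_iff, and_comm] using h1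
  have hx : (fun θ => (v θ : ℝ)) ∈ component b v := by
    rw [mem_component]
    simp [h0]
  rw [h, mem_component] at hx
  funext θ
  have := hx θ
  simp only [h0, Int.cast_zero, mul_zero, Finset.sum_const_zero, zero_add] at this
  exact_mod_cast this

open Classical in
/-- The matrix of `L_α`: the entry in row `j` and column `i` is `1` if `s_α(i) = j`, `-1` if
`s_α(i) = -j`, and `0` otherwise. -/
noncomputable def reflMatrix (b : P.Base) (a : PosRoot b) : Matrix (PosRoot b) (PosRoot b) ℝ :=
  fun j i =>
    if P.reflection (a : ι) (P.root i) = P.root j then 1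
    else if P.reflection (a : ι) (P.root i) = -P.root j then -1
    else 0

open Classical in
/-- The vector `v_{p,α}`; here `P.reflectionPerm α γ` is the index of the root `s_α(γ)`, and
`P.pairing α β = (α, β^∨)`. -/
noncomputable def reflShift (b : P.Base) (a : PosRoot b) (p : ℤ) : PosRoot b → ℝ :=
  fun g =>
    if b.IsPos (P.reflectionPerm a g) then -p * P.pairing a (P.reflectionPerm a g)
    else -1 - p * P.pairing a (P.reflectionPerm a g)

/-- The affine map `F(s_{α,p})` of `ℝ^{Φ⁺}` given by the `Φ⁺`-representation, where `s_{α,p}` is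
the reflection in the hyperplane `(x, α^∨) = p`. -/
noncomputable def phiRep [Finite ι] (b : P.Base) (a : PosRoot b) (p : ℤ) (x : PosRoot b → ℝ) :
    PosRoot b → ℝ :=
  (reflMatrix b a).mulVec x + reflShift b a p

/-- `s_{α,p} ⋄ v = u` for the `Φ⁺`-action, that is `F(s_{α,p})(X_{W_a}[v]) = X_{W_a}[u]`.
The linear reflection `s_α` is `s_{α,0}`. -/
def DiamondEq [Finite ι] (b : P.Base) [P.IsRootSystem] (a : PosRoot b) (p : ℤ) (v u : PosRoot b → ℤ) :
    Prop :=
  phiRep b a p '' component b v = component b u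

/-- The hyperplane `H_{α,k}`. -/
def hyperplane (P : RootPairing ι ℝ V V) (i : ι) (k : ℤ) : Set V :=
  {x | inner ℝ x (P.coroot i) = k}

/-- The strip `H_{α,k}^1`. -/
def strip (P : RootPairing ι ℝ V V) (i : ι) (k : ℤ) : Set V :=
  {x | (k : ℝ) < inner ℝ x (P.coroot i) ∧ inner ℝ x (P.coroot i) < k + 1}

/-- The fundamental polytope `P_H`. -/
def fundPolytope (b : P.Base) : Set V := ⋂ j ∈ b.support, strip P j 0

/-- The complement of the affine hyperplane arrangement. -/
def arrangementCompl (b : P.Base) : Set V :=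
  (⋃ (a : PosRoot b) (k : ℤ), hyperplane P a k)ᶜ

/-- An alcove is a connected component of the complement of the arrangement. -/
def IsAlcove (b : P.Base) (A : Set V) : Prop :=
  ∃ x ∈ arrangementCompl b, A = connectedComponentIn (arrangementCompl b) x

/-- The alcove `A_v = ⋂ H_{α,v_α}^1` attached to an admitted vector `v`. -/
def alcove (b : P.Base) (v : PosRoot b → ℤ) : Set V := ⋂ a : PosRoot b, strip P a (v a)

/-- The set `A` lies below, and `B` above, the hyperplane `H_{α,k}`, and `A` and `B` are adjacent
across it: their closures meet in a common facet, i.e. in a set that affinely spans `H_{α,k}`. -/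
def AdjacentAcross (P : RootPairing ι ℝ V V) (A B : Set V) (i : ι) (k : ℤ) : Prop :=
  (affineSpan ℝ (closure A ∩ closure B) : Set V) = hyperplane P i k ∧
  A ⊆ {x | inner ℝ x (P.coroot i) < k} ∧ B ⊆ {x | (k : ℝ) < inner ℝ x (P.coroot i)}

end ShiVariety

open ShiVariety

/-!
The key fact is Shi's theorem: every solution `v` of Shi's system is the address of an alcove. Extend
`v` to all roots by `v_{-α} = -v_α - 1`. A point of `A_v` is then a solution `x` of the strict
inequalities `‖α‖² v_α < 2 (x, α)`, one for each root `α`. They have integral coefficients, so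
Fourier–Motzkin elimination (`exists_real_solution`) gives a solution unless some list of roots with
sum zero satisfies `0 ≤ ∑ ‖α‖² v_α`. That is excluded by induction on the length of the list
(`ShiSystem.sum_neg`): two members form an obtuse angle, and either they are opposite, and
contribute `-‖α‖²`, or their sum is a root. In that case Shi's inequalities and the
comparison of root lengths (`IsEuclideanNormalized.norm_sq_eq_of_add`) show that replacing the two
roots by their sum does not decrease `∑ ‖α‖² v_α` (`ShiSystem.add_le`).

The alcoves are exactly the nonempty sets `A_v`, and the boundary conditions say that `A_v` lies in
the fundamental polytope; this is the bijection `bijOn_alcove`.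

For admitted `v < u`, a generic segment from `A_v` to `A_u` crosses the separating hyperplanes one
at a time and upwards, and stays in the convex fundamental polytope. The alcove that it enters first
has address `v + e_α ≤ u` (`exists_isAdmitted_update`). Hence `v ⋖ u` if and only if `u = v + e_α` for
some `α` (`covBy_iff`). Both other descriptions of a covering reduce to that, by means of a point `p`
in the relative interior of the common wall (`IsWallPoint`). The reflection in the wall fixes `p`,
so it exchanges the two alcoves, and as it is `s_α` followed by a translation,
`F(s_α)(X[v]) = X[u]` (`IsWallPoint.diamondEq`). All points of the wall near `p` are again
of this kind, so the common facet spans the hyperplane (`IsWallPoint.adjacentAcross`). Conversely, if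
the common facet of `A_v` and `A_u` spans `H_{α,k}`, no other hyperplane can separate the two alcoves
(`AdjacentAcross.step`).
-/

namespace ShiVariety

variable {ι V : Type*} [NormedAddCommGroup V] [InnerProductSpace ℝ V]
  {P : RootPairing ι ℝ V V}

/-! ### A transposition theorem for integral systems of strict inequalities -/

theorem succ_nsmul_mem_addSubsemigroup {M : Type*} [AddCommMonoid M] (T : AddSubsemigroup M)
    {x : M} (hx : x ∈ T) (m : ℕ) : (m + 1) • x ∈ T := by
  induction m with
  | zero => simpa using hx
  | succ m ih => rw [succ_nsmul]; exact T.add_mem ih hx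

theorem zsmul_mem_addSubsemigroup {M : Type*} [AddCommGroup M] (T : AddSubsemigroup M)
    {x : M} (hx : x ∈ T) {m : ℤ} (hm : 0 < m) : m • x ∈ T := by
  obtain ⟨n, rfl⟩ : ∃ n : ℕ, m = ((n + 1 : ℕ) : ℤ) := ⟨(m - 1).toNat, by omega⟩
  rw [natCast_zsmul]
  exact succ_nsmul_mem_addSubsemigroup T hx n

/-- Fourier–Motzkin elimination over the integers: a finite system of strict inequalities
`a < ∑ zᵢ tᵢ` with integral `(z, a)` has a real solution `t` as soon as no sum of its members reads
`a < 0` with `0 ≤ a`. -/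
theorem exists_real_solution (n : ℕ) (S : Finset ((Fin n → ℤ) × ℤ))
    (h : ∀ a : ℤ, ((0 : Fin n → ℤ), a) ∈ AddSubsemigroup.closure (S : Set ((Fin n → ℤ) × ℤ)) →
      a < 0) :
    ∃ t : Fin n → ℝ, ∀ s ∈ S, (s.2 : ℝ) < ∑ i, (s.1 i : ℝ) * t i := by
  classical
  induction n with
  | zero =>
    refine ⟨0, fun s hs => ?_⟩
    have := h s.2 (AddSubsemigroup.subset_closure (by
      rw [show ((0 : Fin 0 → ℤ), s.2) = s from Prod.ext (Subsingleton.elim _ _) rfl]; exact hs))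
    simpa using this
  | succ n ih =>
    let tl : ((Fin (n + 1) → ℤ) × ℤ) → (Fin n → ℤ) × ℤ := fun s => (fun i => s.1 i.succ, s.2)
    let up : ((Fin n → ℤ) × ℤ) → (Fin (n + 1) → ℤ) × ℤ := fun s => (Fin.cons 0 s.1, s.2)
    have up_tl : ∀ s, s.1 0 = 0 → up (tl s) = s := fun s hs =>
      Prod.ext (by rw [← Fin.cons_self_tail s.1, hs]; rfl) rfl
    have up_add : ∀ s s', up (s + s') = up s + up s' := fun s s' => by
      refine Prod.ext (funext fun i => ?_) rfl
      refine Fin.cases ?_ (fun j => ?_) i <;> simp [up]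
    -- the combination of `p` (positive leading coefficient) and `q` (negative one) that
    -- eliminates the first variable
    let comb : ((Fin (n + 1) → ℤ) × ℤ) × ((Fin (n + 1) → ℤ) × ℤ) → (Fin (n + 1) → ℤ) × ℤ :=
      fun r => (-(r.2.1 0)) • r.1 + (r.1.1 0) • r.2
    let Sp := S.filter fun s => 0 < s.1 0
    let Sn := S.filter fun s => s.1 0 < 0
    let S' := (S.filter fun s => s.1 0 = 0).image tl ∪ (Sp ×ˢ Sn).image (tl ∘ comb)
    obtain ⟨t, ht⟩ := ih S' (fun a ha => h a (by
      have key : ∀ s ∈ AddSubsemigroup.closure (S' : Set ((Fin n → ℤ) × ℤ)),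
          up s ∈ AddSubsemigroup.closure (S : Set ((Fin (n + 1) → ℤ) × ℤ)) := by
        intro s hs
        induction hs using AddSubsemigroup.closure_induction with
        | mem s hs =>
          simp only [S', Finset.coe_union, Finset.coe_image, mem_union, mem_image,
            Finset.mem_coe, Finset.mem_filter, Finset.mem_product, Sp, Sn] at hs
          rcases hs with ⟨r, ⟨hr, hr0⟩, rfl⟩ | ⟨r, ⟨⟨hp, hp0⟩, ⟨hq, hq0⟩⟩, rfl⟩
          · rw [up_tl r hr0]; exact AddSubsemigroup.subset_closure hr
          · rw [Function.comp_apply, up_tl _ (by simp [comb]; ring)]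
            exact AddSubsemigroup.add_mem _
              (zsmul_mem_addSubsemigroup _ (AddSubsemigroup.subset_closure hp) (by omega))
              (zsmul_mem_addSubsemigroup _ (AddSubsemigroup.subset_closure hq) hp0)
        | add s s' _ _ h1 h2 => rw [up_add]; exact AddSubsemigroup.add_mem _ h1 h2
      have := key _ ha
      rwa [show up (0, a) = (0, a) from Prod.ext (funext fun i => by
        refine Fin.cases ?_ (fun j => ?_) i <;> simp [up]) rfl] at this))
    let g : ((Fin (n + 1) → ℤ) × ℤ) → ℝ := fun s =>
      ((s.2 : ℝ) - ∑ i : Fin n, (s.1 i.succ : ℝ) * t i) / (s.1 0 : ℝ)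
    obtain ⟨t0, hlo, hhi⟩ := Order.exists_between_finsets (Sp.image g) (Sn.image g) (by
      simp only [Finset.mem_image]
      rintro _ ⟨p, hp, rfl⟩ _ ⟨q, hq, rfl⟩
      have hc := ht (tl (comb (p, q))) (Finset.mem_union_right _ (Finset.mem_image.2
        ⟨(p, q), Finset.mem_product.2 ⟨hp, hq⟩, rfl⟩))
      have hp0 : (0 : ℝ) < (p.1 0 : ℝ) := by exact_mod_cast (Finset.mem_filter.1 hp).2
      have hq0 : ((q.1 0 : ℤ) : ℝ) < 0 := by exact_mod_cast (Finset.mem_filter.1 hq).2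
      have hsum : ∑ i : Fin n, (((tl (comb (p, q))).1 i : ℤ) : ℝ) * t i =
          -(q.1 0 : ℝ) * ∑ i : Fin n, (p.1 i.succ : ℝ) * t i +
            (p.1 0 : ℝ) * ∑ i : Fin n, (q.1 i.succ : ℝ) * t i := by
        rw [Finset.mul_sum, Finset.mul_sum, ← Finset.sum_add_distrib]
        refine Finset.sum_congr rfl fun i _ => ?_
        simp only [tl, comb, Prod.fst_add, Prod.smul_fst, Pi.add_apply, Pi.smul_apply, smul_eq_mul]
        push_cast; ring
      rw [hsum] at hc
      simp only [tl, comb, Prod.snd_add, Prod.smul_snd, smul_eq_mul] at hc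
      push_cast at hc
      simp only [g]
      rw [div_lt_iff₀ hp0, div_mul_eq_mul_div, lt_div_iff_of_neg hq0]
      linarith)
    refine ⟨Fin.cons t0 t, fun s hs => ?_⟩
    rw [Fin.sum_univ_succ]
    simp only [Fin.cons_zero, Fin.cons_succ]
    rcases lt_trichotomy (s.1 0) 0 with h0 | h0 | h0
    · have := hhi (g s) (Finset.mem_image_of_mem _ (Finset.mem_filter.2 ⟨hs, h0⟩))
      have h0' : ((s.1 0 : ℤ) : ℝ) < 0 := by exact_mod_cast h0
      simp only [g] at this
      rw [lt_div_iff_of_neg h0'] at this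
      linarith
    · have := ht (tl s) (Finset.mem_union_left _ (Finset.mem_image_of_mem _
        (Finset.mem_filter.2 ⟨hs, h0⟩)))
      simpa [h0, tl] using this
    · have := hlo (g s) (Finset.mem_image_of_mem _ (Finset.mem_filter.2 ⟨hs, h0⟩))
      have h0' : (0 : ℝ) < ((s.1 0 : ℤ) : ℝ) := by exact_mod_cast h0
      simp only [g] at this
      rw [div_lt_iff₀ h0'] at this
      linarith

/-! ### Roots and coroots in the Euclidean normalization -/

namespace IsEuclideanNormalized

theorem inner_coroot (hP : IsEuclideanNormalized P) (x : V) (i : ι) :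
    ‖P.root i‖ ^ 2 * inner ℝ x (P.coroot i) = 2 * inner ℝ x (P.root i) := by
  have h1 : (0 : ℝ) < ‖P.root i‖ := lt_of_lt_of_le one_pos (hP.one_le_norm i)
  rw [hP.coroot_eq, inner_smul_right, real_inner_self_eq_norm_sq]
  field_simp

theorem norm_sq_pos (hP : IsEuclideanNormalized P) (i : ι) : 0 < ‖P.root i‖ ^ 2 :=
  pow_pos (lt_of_lt_of_le one_pos (hP.one_le_norm i)) 2

theorem inner_reflection_reflection (hP : IsEuclideanNormalized P) (i : ι) (x y : V) :
    inner ℝ (P.reflection i x) (P.reflection i y) = inner ℝ x y := by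
  have h1 := (hP.norm_sq_pos i).ne'
  have hr : ∀ z, P.reflection i z = z - (inner ℝ z (P.coroot i)) • P.root i := fun z => by
    rw [P.reflection_apply, ← hP.toLinearMap_eq]; rfl
  have hx := hP.inner_coroot x i
  have hy := hP.inner_coroot y i
  rw [hr, hr, inner_sub_left, inner_sub_right, inner_sub_right, real_inner_smul_left,
    real_inner_smul_left, inner_smul_right, inner_smul_right, real_inner_self_eq_norm_sq,
    real_inner_comm y (P.root i)]
  generalize inner ℝ x (P.coroot i) = s at *
  generalize inner ℝ y (P.coroot i) = t at *
  generalize inner ℝ x (P.root i) = p at *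
  generalize inner ℝ y (P.root i) = q at *
  linear_combination (t / 2) * hx + (s / 2) * hy

/-- The inner product of `V`, as an invariant form of the root system. -/
def invariantForm (hP : IsEuclideanNormalized P) : P.InvariantForm where
  form := P.toLinearMap
  symm := ⟨fun x y => by simp [hP.toLinearMap_eq, real_inner_comm]⟩
  ne_zero i := by
    rw [hP.toLinearMap_eq, real_inner_self_eq_norm_sq]; exact (hP.norm_sq_pos i).ne'
  isOrthogonal_reflection i x y := by
    rw [hP.toLinearMap_eq, hP.toLinearMap_eq]; exact hP.inner_reflection_reflection i x y

theorem invariantForm_root (hP : IsEuclideanNormalized P) (i : ι) :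
    hP.invariantForm.form (P.root i) (P.root i) = ‖P.root i‖ ^ 2 := by
  rw [← real_inner_self_eq_norm_sq]; exact hP.toLinearMap_eq _ _

theorem pairing_mul_norm_sq (hP : IsEuclideanNormalized P) (i j : ι) :
    P.pairing i j * ‖P.root j‖ ^ 2 = 2 * inner ℝ (P.root i) (P.root j) := by
  rw [← hP.inner_coroot, ← hP.toLinearMap_eq, P.root_coroot_eq_pairing, mul_comm]

section Lengths

variable [Finite ι] [P.IsCrystallographic] [P.IsReduced] [P.IsIrreducible]

theorem exists_norm_sq_eq_intCast (hP : IsEuclideanNormalized P) (i : ι) :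
    ∃ n : ℤ, ‖P.root i‖ ^ 2 = n := by
  obtain ⟨i₀, h₀⟩ := hP.exists_norm_eq_one
  have h := hP.invariantForm.apply_eq_or i i₀
  simp only [hP.invariantForm_root, h₀] at h
  have h1 : 1 ≤ ‖P.root i‖ ^ 2 := one_le_pow₀ (hP.one_le_norm i)
  rcases h with h | h | h | h | h
  · exact ⟨1, by simp [h]⟩
  · exact ⟨2, by simp [h]⟩
  · exact ⟨3, by simp [h]⟩
  · linarith
  · linarith

theorem norm_sq_eq_one_or_eq (hP : IsEuclideanNormalized P) {i : ι} (hi : ‖P.root i‖ ^ 2 ≠ 1)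
    (j : ι) : ‖P.root j‖ ^ 2 = 1 ∨ ‖P.root j‖ ^ 2 = ‖P.root i‖ ^ 2 := by
  obtain ⟨i₀, h₀⟩ := hP.exists_norm_eq_one
  have := hP.invariantForm.apply_eq_or_of_apply_ne (i := i₀) (j := i)
    (by simpa only [hP.invariantForm_root, h₀, one_pow] using hi.symm) j
  simpa only [hP.invariantForm_root, h₀, one_pow] using this

/-- A long root `α + β`, where `α` and `β` form an obtuse angle, has long summands: the length of
`α + β` divides the lengths of `α` and `β`. -/
theorem norm_sq_eq_of_add (hP : IsEuclideanNormalized P) {i j k : ι}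
    (hk : P.root k = P.root i + P.root j) (hij : inner ℝ (P.root i) (P.root j) < 0) :
    ‖P.root k‖ ^ 2 = 1 ∨
      (‖P.root i‖ ^ 2 = ‖P.root k‖ ^ 2 ∧ ‖P.root j‖ ^ 2 = ‖P.root k‖ ^ 2) := by
  by_cases h1 : ‖P.root k‖ ^ 2 = 1
  · exact Or.inl h1
  right
  have hsum : ‖P.root k‖ ^ 2 =
      ‖P.root i‖ ^ 2 + 2 * inner ℝ (P.root i) (P.root j) + ‖P.root j‖ ^ 2 := by
    rw [hk, norm_add_sq_real]
  have hk1 : 1 ≤ ‖P.root k‖ ^ 2 := one_le_pow₀ (hP.one_le_norm k)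
  have hk1' : 1 < ‖P.root k‖ ^ 2 := lt_of_le_of_ne hk1 (Ne.symm h1)
  -- if one summand is short and the other is long, then their pairing would be `-1 / ‖α + β‖²`
  have aux : ∀ z : ℤ, (z : ℝ) * ‖P.root k‖ ^ 2 ≠ -1 := by
    intro z hz
    rcases le_or_gt 0 z with h | h
    · have : (0 : ℝ) ≤ z := by exact_mod_cast h
      nlinarith
    · have : (z : ℝ) ≤ -1 := by exact_mod_cast (show z ≤ -1 by omega)
      nlinarith
  have hz := hP.pairing_mul_norm_sq i j
  have hz' := hP.pairing_mul_norm_sq j i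
  rw [← P.algebraMap_pairingIn ℤ] at hz hz'
  rw [real_inner_comm] at hz'
  simp only [algebraMap_int_eq, eq_intCast] at hz hz'
  rcases hP.norm_sq_eq_one_or_eq h1 i with hi | hi <;>
    rcases hP.norm_sq_eq_one_or_eq h1 j with hj | hj
  · rw [hj, mul_one] at hz
    have hneg : ((P.pairingIn ℤ i j : ℤ) : ℝ) < 0 := by rw [hz]; linarith
    have hle : ((P.pairingIn ℤ i j : ℤ) : ℝ) ≤ -1 := by
      exact_mod_cast Int.le_sub_one_of_lt (Int.cast_lt_zero.1 hneg)
    linarith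
  · exact absurd (by rw [hj] at hz; linarith) (aux (P.pairingIn ℤ i j))
  · exact absurd (by rw [hi] at hz'; linarith) (aux (P.pairingIn ℤ j i))
  · exact ⟨hi, hj⟩

end Lengths

end IsEuclideanNormalized

/-! ### Positive roots and negatives of roots -/

theorem root_reflectionPerm_self (i : ι) : P.root (P.reflectionPerm i i) = -P.root i := by
  rw [P.root_reflectionPerm, P.reflection_apply_self]

theorem coroot_reflectionPerm_self (i : ι) : P.coroot (P.reflectionPerm i i) = -P.coroot i := by
  rw [P.coroot_reflectionPerm, P.coreflection_apply_self]

theorem reflectionPerm_self_self (i : ι) :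
    P.reflectionPerm (P.reflectionPerm i i) (P.reflectionPerm i i) = i := by
  apply P.root.injective
  rw [root_reflectionPerm_self, root_reflectionPerm_self, neg_neg]

theorem eq_reflectionPerm_self {i j : ι} (h : P.root j = -P.root i) :
    j = P.reflectionPerm i i :=
  P.root.injective (by rw [root_reflectionPerm_self, h])

theorem isPos_neg_iff (b : P.Base) (i : ι) : b.IsPos (P.reflectionPerm i i) ↔ ¬ b.IsPos i :=
  RootPairing.Base.IsPos.neg_iff_not b i

/-- The height of roots extends to a linear form. Its sign on a root, and on the coroot, which is a
positive multiple of the root, tells whether the root is positive. -/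
theorem exists_height_functional (b : P.Base) [P.IsRootSystem] :
    ∃ f : V →ₗ[ℝ] ℝ, ∀ i, f (P.root i) = b.height i := by
  refine ⟨b.toWeightBasis.constr ℝ fun _ => 1, fun i => ?_⟩
  obtain ⟨f, -, -, hf⟩ := b.exists_root_eq_sum_int i
  rw [RootPairing.Base.height_eq_sum hf, hf, map_sum, Int.cast_sum]
  refine Finset.sum_congr rfl fun j hj => ?_
  rw [map_zsmul, ← b.toWeightBasis_apply ⟨j, hj⟩, Module.Basis.constr_basis]
  simp

/-- A positive coroot is a combination of simple coroots with coefficients in `ℕ`. -/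
theorem exists_coroot_eq_sum_nat [P.IsRootSystem] (hP : IsEuclideanNormalized P)
    (b : P.Base) {i : ι} (hi : b.IsPos i) :
    ∃ c : ι → ℕ, P.coroot i = ∑ j ∈ b.support, (c j : ℝ) • P.coroot j ∧
      corootHeight b i = ∑ j ∈ b.support, (c j : ℤ) ∧ ∃ j ∈ b.support, c j ≠ 0 := by
  obtain ⟨f, hf⟩ := exists_height_functional b
  have fpos : ∀ {k}, b.IsPos k → 0 < f (P.coroot k) := fun {k} hk => by
    rw [hP.coroot_eq, map_smul, hf, real_inner_self_eq_norm_sq, smul_eq_mul]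
    have : (0 : ℝ) < b.height k := by exact_mod_cast hk
    have := hP.norm_sq_pos k
    positivity
  obtain ⟨c, -, hc | hc⟩ := b.flip.exists_root_eq_sum_nat_or_neg i
  · change P.coroot i = ∑ j ∈ b.support, c j • P.coroot j at hc
    have hc' : P.coroot i = ∑ j ∈ b.support, (c j : ℝ) • P.coroot j := by
      simpa only [Nat.cast_smul_eq_nsmul] using hc
    refine ⟨c, hc', ?_, ?_⟩
    · refine RootPairing.Base.height_eq_sum (b := b.flip) (f := fun j => (c j : ℤ)) ?_
      change P.coroot i = ∑ j ∈ b.support, (c j : ℤ) • P.coroot j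
      simpa only [natCast_zsmul] using hc
    · by_contra! h
      refine absurd (fpos hi) (not_lt.2 ?_)
      rw [hc', Finset.sum_eq_zero (fun j hj => by simp [h j hj]), map_zero]
  · exfalso
    change P.coroot i = -∑ j ∈ b.support, c j • P.coroot j at hc
    have h1 := fpos hi
    rw [hc, map_neg, map_sum] at h1
    have : 0 ≤ ∑ j ∈ b.support, f (c j • P.coroot j) := Finset.sum_nonneg fun j hj => by
      rw [map_nsmul]
      exact nsmul_nonneg (fpos (RootPairing.Base.isPos_of_mem_support hj)).le _
    linarith

/-- Coroots of distinct positive roots are not proportional. -/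
theorem linearIndependent_coroot_pair [Finite ι] [P.IsReduced] (hP : IsEuclideanNormalized P)
    (b : P.Base) {a c : PosRoot b} (h : a ≠ c) :
    LinearIndependent ℝ ![P.coroot a, P.coroot c] := by
  have h1 := (RootPairing.IsReduced.linearIndependent_iff (P := P) (i := a) (j := c)).2
    ⟨fun h' => h (Subtype.ext h'), fun h' => by
      have : (a : ι) = P.reflectionPerm c c := eq_reflectionPerm_self h'
      have h2 := a.2
      rw [this, isPos_neg_iff] at h2
      exact h2 c.2⟩
  rw [LinearIndependent.pair_iff] at h1 ⊢
  intro s t hst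
  have e : ∀ i, (2 / inner ℝ (P.root i) (P.root i)) ≠ 0 := fun i => by
    rw [real_inner_self_eq_norm_sq]; exact (div_pos two_pos (hP.norm_sq_pos i)).ne'
  have := h1 (s * (2 / inner ℝ (P.root a) (P.root a))) (t * (2 / inner ℝ (P.root c) (P.root c)))
    (by rw [mul_smul, mul_smul, ← hP.coroot_eq, ← hP.coroot_eq, hst])
  exact ⟨(mul_eq_zero.1 this.1).resolve_right (e _), (mul_eq_zero.1 this.2).resolve_right (e _)⟩

/-! ### Solutions of Shi's system are addresses of alcoves -/

open Classical in
/-- The extension of an address from the positive roots to all roots, by `v_{-α} = -v_α - 1`: if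
`v_α < (x, α^∨) < v_α + 1`, then `v_{-α} < (x, -α^∨) < v_{-α} + 1`. -/
noncomputable def extAddress (b : P.Base) (v : PosRoot b → ℤ) (i : ι) : ℤ :=
  if h : b.IsPos i then v ⟨i, h⟩
  else -v ⟨P.reflectionPerm i i, (isPos_neg_iff b i).2 h⟩ - 1

theorem extAddress_pos (b : P.Base) (v : PosRoot b → ℤ) (a : PosRoot b) :
    extAddress b v a = v a := by
  rw [extAddress, dif_pos a.2]

theorem extAddress_neg (b : P.Base) (v : PosRoot b → ℤ) (i : ι) :
    extAddress b v (P.reflectionPerm i i) = -extAddress b v i - 1 := by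
  by_cases h : b.IsPos i
  · have h' : ¬ b.IsPos (P.reflectionPerm i i) := by rw [isPos_neg_iff]; exact not_not.2 h
    rw [extAddress, dif_neg h', extAddress, dif_pos h]
    simp only [reflectionPerm_self_self]
  · have h' : b.IsPos (P.reflectionPerm i i) := (isPos_neg_iff b i).2 h
    rw [extAddress, dif_pos h', extAddress, dif_neg h]
    ring

theorem norm_root_neg (i : ι) : ‖P.root (P.reflectionPerm i i)‖ = ‖P.root i‖ := by
  rw [root_reflectionPerm_self, norm_neg]

/-- Shi's inequalities in symmetric form, for three roots, positive or not, whose sum is zero: the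
sum of the intervals `‖α‖² [v_α, v_α + 1]` contains `0` in its interior. -/
theorem ShiSystem.sum_zero {b : P.Base} {v : PosRoot b → ℤ} (hv : ShiSystem b v) {i j k : ι}
    (h : P.root i + P.root j + P.root k = 0) :
    ‖P.root i‖ ^ 2 * extAddress b v i + ‖P.root j‖ ^ 2 * extAddress b v j
        + ‖P.root k‖ ^ 2 * extAddress b v k + 1 ≤ 0 ∧
      1 ≤ ‖P.root i‖ ^ 2 * (extAddress b v i + 1) + ‖P.root j‖ ^ 2 * (extAddress b v j + 1)
        + ‖P.root k‖ ^ 2 * (extAddress b v k + 1) := by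
  -- the case of two positive roots
  have two : ∀ {i j k : ι}, P.root i + P.root j + P.root k = 0 → b.IsPos i → b.IsPos j →
      ¬ b.IsPos k →
      ‖P.root i‖ ^ 2 * extAddress b v i + ‖P.root j‖ ^ 2 * extAddress b v j
        + ‖P.root k‖ ^ 2 * extAddress b v k + 1 ≤ 0 ∧
      1 ≤ ‖P.root i‖ ^ 2 * (extAddress b v i + 1) + ‖P.root j‖ ^ 2 * (extAddress b v j + 1)
        + ‖P.root k‖ ^ 2 * (extAddress b v k + 1) := by
    intro i j k h hi hj hk
    have hk' := (isPos_neg_iff b k).2 hk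
    obtain ⟨h1, h2⟩ := hv ⟨i, hi⟩ ⟨j, hj⟩ ⟨_, hk'⟩ (by
      rw [root_reflectionPerm_self]; exact (eq_neg_of_add_eq_zero_left h).symm)
    rw [← extAddress_pos b v ⟨i, hi⟩, ← extAddress_pos b v ⟨j, hj⟩,
      ← extAddress_pos b v ⟨_, hk'⟩] at h1 h2
    simp only [extAddress_neg, norm_root_neg] at h1 h2
    push_cast at h1 h2
    constructor <;> linarith
  -- the case of two negative roots reduces to it by changing all signs
  have two' : ∀ {i j k : ι}, P.root i + P.root j + P.root k = 0 → ¬ b.IsPos i → ¬ b.IsPos j →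
      b.IsPos k →
      ‖P.root i‖ ^ 2 * extAddress b v i + ‖P.root j‖ ^ 2 * extAddress b v j
        + ‖P.root k‖ ^ 2 * extAddress b v k + 1 ≤ 0 ∧
      1 ≤ ‖P.root i‖ ^ 2 * (extAddress b v i + 1) + ‖P.root j‖ ^ 2 * (extAddress b v j + 1)
        + ‖P.root k‖ ^ 2 * (extAddress b v k + 1) := by
    intro i j k h hi hj hk
    obtain ⟨h1, h2⟩ := two (i := P.reflectionPerm i i) (j := P.reflectionPerm j j)
      (k := P.reflectionPerm k k)
      (by simp only [root_reflectionPerm_self]; rw [← neg_add, ← neg_add, h, neg_zero])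
      ((isPos_neg_iff b i).2 hi) ((isPos_neg_iff b j).2 hj)
      (by rw [isPos_neg_iff]; exact not_not.2 hk)
    simp only [extAddress_neg, norm_root_neg] at h1 h2
    push_cast at h1 h2
    constructor <;> linarith
  have hpos : ∀ {i j k : ι}, P.root i + P.root j + P.root k = 0 → b.IsPos i → b.IsPos j →
      ¬ b.IsPos k := fun {i j k} h hi hj hk => by
    refine (isPos_neg_iff b k).1 (hi.add hj ?_) hk
    rw [root_reflectionPerm_self]; exact (eq_neg_of_add_eq_zero_left h).symm
  have hneg : ∀ {i j k : ι}, P.root i + P.root j + P.root k = 0 → ¬ b.IsPos i → ¬ b.IsPos j →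
      b.IsPos k := fun {i j k} h hi hj => by
    rw [← isPos_neg_iff] at hi hj
    have := hpos (k := P.reflectionPerm k k)
      (by simp only [root_reflectionPerm_self]; rw [← neg_add, ← neg_add, h, neg_zero]) hi hj
    rwa [isPos_neg_iff, not_not] at this
  have h' : P.root i + P.root k + P.root j = 0 := by rw [← h]; abel
  have h'' : P.root j + P.root k + P.root i = 0 := by rw [← h]; abel
  by_cases hi : b.IsPos i <;> by_cases hj : b.IsPos j
  · exact two h hi hj (hpos h hi hj)
  · by_cases hk : b.IsPos k
    · obtain ⟨h1, h2⟩ := two h' hi hk hj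
      constructor <;> linarith
    · obtain ⟨h1, h2⟩ := two' h'' hj hk hi
      constructor <;> linarith
  · by_cases hk : b.IsPos k
    · obtain ⟨h1, h2⟩ := two h'' hj hk hi
      constructor <;> linarith
    · obtain ⟨h1, h2⟩ := two' h' hi hk hj
      constructor <;> linarith
  · exact two' h hi hj (hneg h hi hj)

section

variable [Finite ι] [P.IsCrystallographic] [P.IsReduced] [P.IsIrreducible]

/-- For an obtuse angle, the weighted address is superadditive. In Shi's inequality, which bounds
`‖α‖² v_α + ‖β‖² v_β` by `‖α + β‖² v_{α + β} + ‖α + β‖² - 1`, the error term disappears: either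
`‖α + β‖² = 1`, or all terms are multiples of `‖α + β‖²`. -/
theorem ShiSystem.add_le (hP : IsEuclideanNormalized P) {b : P.Base} {v : PosRoot b → ℤ}
    (hv : ShiSystem b v) {i j k : ι} (hk : P.root k = P.root i + P.root j)
    (hij : inner ℝ (P.root i) (P.root j) < 0) :
    ‖P.root i‖ ^ 2 * extAddress b v i + ‖P.root j‖ ^ 2 * extAddress b v j ≤
      ‖P.root k‖ ^ 2 * extAddress b v k := by
  have h := (hv.sum_zero (i := i) (j := j) (k := P.reflectionPerm k k)
    (by rw [root_reflectionPerm_self, hk, add_neg_cancel])).1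
  rw [extAddress_neg, norm_root_neg] at h
  push_cast at h
  have hpos := hP.norm_sq_pos k
  rcases hP.norm_sq_eq_of_add hk hij with h1 | ⟨hi, hj⟩
  · rw [h1] at h ⊢; linarith
  · rw [hi, hj] at h ⊢
    have h2 : ((extAddress b v i + extAddress b v j : ℤ) : ℝ) < (extAddress b v k + 1 : ℤ) := by
      push_cast
      by_contra! hcon
      nlinarith
    have h3 : ((extAddress b v i + extAddress b v j : ℤ) : ℝ) ≤ (extAddress b v k : ℤ) := by
      exact_mod_cast Int.lt_add_one_iff.1 (Int.cast_lt.1 h2)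
    push_cast at h3
    nlinarith

/-- Among roots with sum zero two form an obtuse angle; they are opposite or their sum is a root,
and replacing them by their sum shortens the list. -/
theorem ShiSystem.sum_neg (hP : IsEuclideanNormalized P) {b : P.Base} {v : PosRoot b → ℤ}
    (hv : ShiSystem b v) (m : Multiset ι) (h0 : m ≠ 0) (hm : (m.map P.root).sum = 0) :
    (m.map fun i => ‖P.root i‖ ^ 2 * (extAddress b v i : ℝ)).sum < 0 := by
  induction hn : m.card using Nat.strong_induction_on generalizing m with
  | _ n ih =>
  subst hn
  obtain ⟨i, hi⟩ := Multiset.exists_mem_of_ne_zero h0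
  obtain ⟨m, rfl⟩ := Multiset.exists_cons_of_mem hi
  rw [Multiset.map_cons, Multiset.sum_cons] at hm
  obtain ⟨j, hj, hij⟩ : ∃ j ∈ m, inner ℝ (P.root i) (P.root j) < 0 := by
    by_contra! hcon
    have h1 := congrArg (innerₗ V (P.root i)) hm
    rw [map_add, map_zero, map_multiset_sum, Multiset.map_map] at h1
    have h2 : 0 ≤ (m.map (innerₗ V (P.root i) ∘ P.root)).sum :=
      Multiset.sum_nonneg fun x hx => by
        obtain ⟨j, hj, rfl⟩ := Multiset.mem_map.1 hx
        exact hcon j hj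
    have h3 : innerₗ V (P.root i) (P.root i) = ‖P.root i‖ ^ 2 := real_inner_self_eq_norm_sq _
    have := hP.norm_sq_pos i
    linarith
  obtain ⟨m, rfl⟩ := Multiset.exists_cons_of_mem hj
  rw [Multiset.map_cons, Multiset.sum_cons] at hm
  simp only [Multiset.map_cons, Multiset.sum_cons]
  by_cases hneg : P.root i = -P.root j
  · have hi' := eq_reflectionPerm_self hneg
    have hsum : ‖P.root i‖ ^ 2 * (extAddress b v i : ℝ) +
        ‖P.root j‖ ^ 2 * (extAddress b v j : ℝ) < 0 := by
      rw [hi', extAddress_neg, norm_root_neg]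
      push_cast
      linarith [hP.norm_sq_pos j]
    rcases eq_or_ne m 0 with rfl | hm0
    · simpa using hsum
    · have := ih m.card (by simp) m hm0 (by
        rwa [hneg, neg_add_cancel_left] at hm) rfl
      linarith
  · have hpair : P.pairingIn ℤ i j < 0 := by
      have h1 := hP.pairing_mul_norm_sq i j
      have h2 := hP.norm_sq_pos j
      have h3 : P.pairing i j < 0 := by
        by_contra! hcon
        nlinarith
      rw [← P.algebraMap_pairingIn ℤ, algebraMap_int_eq, eq_intCast] at h3
      exact_mod_cast h3
    obtain ⟨k, hk⟩ := P.root_add_root_mem_of_pairingIn_neg hpair hneg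
    have := ih (k ::ₘ m).card (by simp) (k ::ₘ m) (Multiset.cons_ne_zero) (by
      rw [Multiset.map_cons, Multiset.sum_cons, hk, add_assoc, hm]) rfl
    rw [Multiset.map_cons, Multiset.sum_cons] at this
    linarith [hv.add_le hP hk hij]

/-- Shi's theorem: a solution of Shi's system is the address of a (nonempty) alcove. -/
theorem ShiSystem.alcove_nonempty [P.IsRootSystem] (hP : IsEuclideanNormalized P) {b : P.Base}
    {v : PosRoot b → ℤ} (hv : ShiSystem b v) [FiniteDimensional ℝ V] : (alcove b v).Nonempty := by
  classical
  cases nonempty_fintype ι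
  choose N hN using hP.exists_norm_sq_eq_intCast
  choose z _ _ hz using b.exists_root_eq_sum_int
  let e := Fintype.equivFin b.support
  let vec : ι → (Fin (Fintype.card b.support) → ℤ) × ℤ := fun i =>
    (fun r => z i (e.symm r), N i * extAddress b v i)
  have hroot : ∀ i, P.root i = ∑ r, ((vec i).1 r : ℝ) • P.root (e.symm r) := fun i => by
    conv_lhs => rw [hz i, ← Finset.sum_coe_sort, ← e.symm.sum_comp]
    exact Finset.sum_congr rfl fun r _ => (Int.cast_smul_eq_zsmul ℝ _ _).symm
  have hvec2 : ∀ i, ((vec i).2 : ℝ) = ‖P.root i‖ ^ 2 * extAddress b v i := fun i => by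
    simp [vec, hN]
  obtain ⟨t, ht⟩ := exists_real_solution _ (Finset.univ.image vec) (fun a ha => by
    have key : ∀ s ∈ AddSubsemigroup.closure
        ((Finset.univ.image vec : Finset _) : Set ((Fin (Fintype.card b.support) → ℤ) × ℤ)),
        ∃ m : Multiset ι, m ≠ 0 ∧ (m.map P.root).sum = ∑ r, (s.1 r : ℝ) • P.root (e.symm r) ∧
          (m.map fun i => ‖P.root i‖ ^ 2 * (extAddress b v i : ℝ)).sum = s.2 := by
      intro s hs
      induction hs using AddSubsemigroup.closure_induction with
      | mem s hs =>
        simp only [Finset.coe_image, Finset.coe_univ, image_univ, mem_range] at hs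
        obtain ⟨i, rfl⟩ := hs
        exact ⟨{i}, by simp, by simpa using hroot i, by rw [hvec2]; simp⟩
      | add s s' _ _ h h' =>
        obtain ⟨m, h0, h1, h2⟩ := h
        obtain ⟨m', -, h1', h2'⟩ := h'
        refine ⟨m + m', by simp [h0], ?_, by simp [h2, h2']⟩
        simp [h1, h1', add_smul, Finset.sum_add_distrib]
    obtain ⟨m, h0, h1, h2⟩ := key _ ha
    have := hv.sum_neg hP m h0 (by simpa using h1)
    rw [h2] at this
    exact_mod_cast this)
  -- the point whose doubled inner products with the simple roots are the `t r`
  let f : V →ₗ[ℝ] ℝ := b.toWeightBasis.constr ℝ fun j => t (e j)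
  have hf : ∀ j : b.support, f (P.root j) = t (e j) := fun j => by
    rw [← b.toWeightBasis_apply j, Module.Basis.constr_basis]
  let y : V := (InnerProductSpace.toDual ℝ V).symm (LinearMap.toContinuousLinearMap f)
  have hy : ∀ w, inner ℝ y w = f w := fun w => by
    simp [y]
  have hlt : ∀ i, (extAddress b v i : ℝ) < inner ℝ ((2⁻¹ : ℝ) • y) (P.coroot i) := fun i => by
    have h1 := ht (vec i) (Finset.mem_image_of_mem _ (Finset.mem_univ i))
    have h2 : f (P.root i) = ∑ r, ((vec i).1 r : ℝ) * t r := by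
      rw [hroot, map_sum]
      refine Finset.sum_congr rfl fun r _ => ?_
      rw [map_smul, hf, e.apply_symm_apply, smul_eq_mul]
    rw [hvec2, ← h2, ← hy] at h1
    have h3 := hP.inner_coroot ((2⁻¹ : ℝ) • y) i
    rw [real_inner_smul_left y (P.root i), mul_inv_cancel_left₀ two_ne_zero] at h3
    rw [← h3] at h1
    exact lt_of_mul_lt_mul_left h1 (hP.norm_sq_pos i).le
  refine ⟨(2⁻¹ : ℝ) • y, mem_iInter.2 fun a => ⟨?_, ?_⟩⟩
  · have := hlt a
    rwa [extAddress_pos] at this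
  · have := hlt (P.reflectionPerm a a)
    rw [extAddress_neg, extAddress_pos, coroot_reflectionPerm_self, inner_neg_right] at this
    push_cast at this
    linarith

end

/-! ### Alcoves and their addresses -/

theorem mem_alcove {b : P.Base} {v : PosRoot b → ℤ} {x : V} :
    x ∈ alcove b v ↔ ∀ a : PosRoot b,
      (v a : ℝ) < inner ℝ x (P.coroot a) ∧ inner ℝ x (P.coroot a) < v a + 1 :=
  mem_iInter

theorem isOpen_strip (P : RootPairing ι ℝ V V) (i : ι) (k : ℤ) : IsOpen (strip P i k) := by
  have hc : Continuous fun x : V => (inner ℝ x (P.coroot i) : ℝ) := by fun_prop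
  exact (isOpen_lt continuous_const hc).inter (isOpen_lt hc continuous_const)

theorem convex_strip (P : RootPairing ι ℝ V V) (i : ι) (k : ℤ) : Convex ℝ (strip P i k) := by
  have hl : IsLinearMap ℝ fun x : V => inner ℝ x (P.coroot i) :=
    ⟨fun x y => inner_add_left x y _, fun c x => real_inner_smul_left x _ c⟩
  exact (convex_halfSpace_gt hl _).inter (convex_halfSpace_lt hl _)

theorem isOpen_alcove [Finite ι] (b : P.Base) (v : PosRoot b → ℤ) : IsOpen (alcove b v) :=
  isOpen_iInter_of_finite fun a => isOpen_strip P a (v a)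

theorem convex_alcove (b : P.Base) (v : PosRoot b → ℤ) : Convex ℝ (alcove b v) :=
  convex_iInter fun a => convex_strip P a (v a)

theorem isOpen_fundPolytope (b : P.Base) : IsOpen (fundPolytope b) :=
  isOpen_biInter_finset fun j _ => isOpen_strip P j 0

theorem convex_fundPolytope (b : P.Base) : Convex ℝ (fundPolytope b) :=
  convex_iInter₂ fun j _ => convex_strip P j 0

theorem mem_arrangementCompl {b : P.Base} {x : V} :
    x ∈ arrangementCompl b ↔ ∀ (a : PosRoot b) (k : ℤ), inner ℝ x (P.coroot a) ≠ k := by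
  simp [arrangementCompl, hyperplane]

theorem alcove_subset_arrangementCompl (b : P.Base) (v : PosRoot b → ℤ) :
    alcove b v ⊆ arrangementCompl b := fun x hx => by
  rw [mem_arrangementCompl]
  rintro a k hk
  have h := mem_alcove.1 hx a
  rw [hk] at h
  have h1 : v a < k := by exact_mod_cast h.1
  have h2 : k < v a + 1 := by exact_mod_cast h.2
  omega

theorem mem_alcove_floor {b : P.Base} {x : V} (hx : x ∈ arrangementCompl b) :
    x ∈ alcove b fun a => ⌊(inner ℝ x (P.coroot a) : ℝ)⌋ :=
  mem_alcove.2 fun a => ⟨lt_of_le_of_ne (Int.floor_le _)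
    (mem_arrangementCompl.1 hx a _).symm, Int.lt_floor_add_one _⟩

theorem eq_of_mem_alcove {b : P.Base} {v u : PosRoot b → ℤ} {x : V} (hv : x ∈ alcove b v)
    (hu : x ∈ alcove b u) : v = u := by
  funext a
  have h1 := mem_alcove.1 hv a
  have h2 := mem_alcove.1 hu a
  have h3 : v a < u a + 1 := by exact_mod_cast h1.1.trans h2.2
  have h4 : u a < v a + 1 := by exact_mod_cast h2.1.trans h1.2
  omega

theorem connectedComponentIn_eq_alcove {b : P.Base} {v : PosRoot b → ℤ} {x : V}
    (hx : x ∈ alcove b v) : connectedComponentIn (arrangementCompl b) x = alcove b v := by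
  refine Subset.antisymm (fun y hy => mem_alcove.2 fun a => ?_)
    ((convex_alcove b v).isPreconnected.subset_connectedComponentIn hx
      (alcove_subset_arrangementCompl b v))
  have hc : IsPreconnected (connectedComponentIn (arrangementCompl b) x) :=
    isPreconnected_connectedComponentIn
  have hx' : x ∈ connectedComponentIn (arrangementCompl b) x :=
    mem_connectedComponentIn (alcove_subset_arrangementCompl b v hx)
  have hcont : ContinuousOn (fun z : V => (inner ℝ z (P.coroot a) : ℝ))
      (connectedComponentIn (arrangementCompl b) x) := by fun_prop
  have hsub := connectedComponentIn_subset (arrangementCompl b) x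
  have hxa := mem_alcove.1 hx a
  constructor
  · by_contra! hcon
    obtain ⟨z, hz, hz'⟩ := hc.intermediate_value hy hx' hcont ⟨hcon, hxa.1.le⟩
    exact mem_arrangementCompl.1 (hsub hz) a _ hz'
  · by_contra! hcon
    obtain ⟨z, hz, hz'⟩ := hc.intermediate_value hx' hy hcont ⟨hxa.2.le, hcon⟩
    exact mem_arrangementCompl.1 (hsub hz) a (v a + 1) (by push_cast; exact hz')

theorem isAlcove_iff {b : P.Base} {A : Set V} :
    IsAlcove b A ↔ ∃ v : PosRoot b → ℤ, (alcove b v).Nonempty ∧ A = alcove b v := by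
  constructor
  · rintro ⟨x, hx, rfl⟩
    exact ⟨_, ⟨x, mem_alcove_floor hx⟩, connectedComponentIn_eq_alcove (mem_alcove_floor hx)⟩
  · rintro ⟨v, ⟨x, hx⟩, rfl⟩
    exact ⟨x, alcove_subset_arrangementCompl b v hx, (connectedComponentIn_eq_alcove hx).symm⟩

/-! ### Admitted vectors and alcoves in the fundamental polytope -/

theorem IsAdmissible.simple_eq_zero {b : P.Base} {v : PosRoot b → ℤ} (hv : IsAdmissible b v)
    (j : b.support) : v (simplePos b j) = 0 := by
  have h1 := hv (simplePos b j)
  have h2 : corootHeight b (simplePos b j : ι) = 1 :=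
    RootPairing.Base.height_one_of_mem_support (b := b.flip) (i := (j : ι)) j.2
  rw [h2] at h1
  exact le_antisymm h1.2 h1.1

theorem IsAdmissible.alcove_subset {b : P.Base} {v : PosRoot b → ℤ} (hv : IsAdmissible b v) :
    alcove b v ⊆ fundPolytope b := fun x hx => by
  refine mem_iInter₂.2 fun j hj => ?_
  have := mem_alcove.1 hx (simplePos b ⟨j, hj⟩)
  rwa [hv.simple_eq_zero] at this

theorem shiSystem_of_mem_alcove [Finite ι] [P.IsCrystallographic] [P.IsReduced]
    [P.IsIrreducible] (hP : IsEuclideanNormalized P) {b : P.Base} {v : PosRoot b → ℤ} {x : V}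
    (hx : x ∈ alcove b v) : ShiSystem b v := by
  intro a c d hd
  rw [mem_alcove] at hx
  have hsum : ‖P.root d‖ ^ 2 * inner ℝ x (P.coroot d) =
      ‖P.root a‖ ^ 2 * inner ℝ x (P.coroot a) + ‖P.root c‖ ^ 2 * inner ℝ x (P.coroot c) := by
    rw [hP.inner_coroot, hP.inner_coroot, hP.inner_coroot, hd, inner_add_right, mul_add]
  have l : ∀ i : PosRoot b,
      ‖P.root i‖ ^ 2 * v i < ‖P.root i‖ ^ 2 * inner ℝ x (P.coroot i) := fun i =>
    mul_lt_mul_of_pos_left (hx i).1 (hP.norm_sq_pos i)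
  have u : ∀ i : PosRoot b,
      ‖P.root i‖ ^ 2 * inner ℝ x (P.coroot i) < ‖P.root i‖ ^ 2 * (v i + 1) := fun i =>
    mul_lt_mul_of_pos_left (hx i).2 (hP.norm_sq_pos i)
  have h1 : ‖P.root a‖ ^ 2 * v a + ‖P.root c‖ ^ 2 * v c < ‖P.root d‖ ^ 2 * (v d + 1) := by
    linarith [l a, l c, u d]
  have h2 : ‖P.root d‖ ^ 2 * v d < ‖P.root a‖ ^ 2 * (v a + 1) + ‖P.root c‖ ^ 2 * (v c + 1) := by
    linarith [u a, u c, l d]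
  obtain ⟨na, ha⟩ := hP.exists_norm_sq_eq_intCast a
  obtain ⟨nc, hc⟩ := hP.exists_norm_sq_eq_intCast c
  obtain ⟨nd, hd⟩ := hP.exists_norm_sq_eq_intCast d
  rw [ha, hc, hd] at h1 h2 ⊢
  norm_cast at h1 h2 ⊢
  constructor <;> linarith

theorem isAdmissible_of_mem_alcove [P.IsRootSystem] (hP : IsEuclideanNormalized P) {b : P.Base}
    {v : PosRoot b → ℤ} {x : V} (hx : x ∈ alcove b v) (hx' : x ∈ fundPolytope b) :
    IsAdmissible b v := by
  intro a
  obtain ⟨c, hc, hh, j₀, hj₀, hcj₀⟩ := exists_coroot_eq_sum_nat hP b a.2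
  have hs : ∀ j ∈ b.support,
      0 < inner ℝ x (P.coroot j) ∧ inner ℝ x (P.coroot j) < 1 := fun j hj => by
    simpa [strip] using mem_iInter₂.1 hx' j hj
  have h1 : inner ℝ x (P.coroot a) = ∑ j ∈ b.support, (c j : ℝ) * inner ℝ x (P.coroot j) := by
    rw [hc, inner_sum]
    exact Finset.sum_congr rfl fun j _ => inner_smul_right _ _ _
  have hpos : 0 < (c j₀ : ℝ) := by exact_mod_cast Nat.pos_of_ne_zero hcj₀
  have h2 : 0 < inner ℝ x (P.coroot a) := by
    rw [h1]
    exact Finset.sum_pos' (fun j hj => mul_nonneg (Nat.cast_nonneg _) (hs j hj).1.le)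
      ⟨j₀, hj₀, mul_pos hpos (hs j₀ hj₀).1⟩
  have h3 : inner ℝ x (P.coroot a) < corootHeight b a := by
    rw [h1, hh]
    push_cast
    exact Finset.sum_lt_sum
      (fun j hj => mul_le_of_le_one_right (Nat.cast_nonneg _) (hs j hj).2.le)
      ⟨j₀, hj₀, mul_lt_of_lt_one_right hpos (hs j₀ hj₀).2⟩
  have h := mem_alcove.1 hx a
  have h4 : 0 < v a + 1 := by exact_mod_cast h2.trans h.2
  have h5 : v a < corootHeight b a := by exact_mod_cast h.1.trans h3
  exact ⟨by omega, by omega⟩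

theorem bijOn_alcove [Finite ι] [FiniteDimensional ℝ V] [P.IsRootSystem] [P.IsCrystallographic]
    [P.IsReduced] [P.IsIrreducible] (hP : IsEuclideanNormalized P) (b : P.Base) :
    BijOn (fun v : AdmittedVector b => alcove b v.1) univ
      {A | IsAlcove b A ∧ A ⊆ fundPolytope b} := by
  refine ⟨fun v _ => ⟨isAlcove_iff.2 ⟨v.1, v.2.2.alcove_nonempty hP, rfl⟩,
    v.2.1.alcove_subset⟩, fun v _ u _ h => ?_, ?_⟩
  · obtain ⟨x, hx⟩ := v.2.2.alcove_nonempty hP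
    have hx' := hx
    rw [show alcove b v.1 = alcove b u.1 from h] at hx'
    exact Subtype.ext (eq_of_mem_alcove hx hx')
  · rintro A ⟨hA, hA'⟩
    obtain ⟨v, ⟨x, hx⟩, rfl⟩ := isAlcove_iff.1 hA
    exact ⟨⟨v, isAdmissible_of_mem_alcove hP hx (hA' hx), shiSystem_of_mem_alcove hP hx⟩,
      mem_univ _, rfl⟩

open Filter Topology

/-! ### Crossing walls and the covering relation -/

/-- `p` lies on the upper wall of type `α` of the alcove with address `v`, and on no other
hyperplane bounding that alcove: `(p, α^∨) = v_α + 1`, while `v_β < (p, β^∨) < v_β + 1` for the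
positive roots `β ≠ α`. -/
def IsWallPoint (b : P.Base) (v : PosRoot b → ℤ) (a : PosRoot b) (p : V) : Prop :=
  inner ℝ p (P.coroot a) = v a + 1 ∧ ∀ c, c ≠ a →
    (v c : ℝ) < inner ℝ p (P.coroot c) ∧ inner ℝ p (P.coroot c) < v c + 1

theorem inner_lineMap (x y w : V) (t : ℝ) : inner ℝ (AffineMap.lineMap x y t) w =
    inner ℝ x w + t * (inner ℝ y w - inner ℝ x w) := by
  rw [AffineMap.lineMap_apply, vadd_eq_add, vsub_eq_sub, inner_add_left, real_inner_smul_left,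
    inner_sub_left]
  ring

theorem dense_inner_ne {w : V} (hw : w ≠ 0) (r : ℝ) : Dense {x : V | inner ℝ x w ≠ r} := by
  intro x
  by_cases hx : inner ℝ x w = r
  · have ht : Tendsto (fun s : ℝ => x + s • w) (𝓝[>] 0) (𝓝 x) := by
      have : Continuous fun s : ℝ => x + s • w := by fun_prop
      simpa using (this.tendsto 0).mono_left nhdsWithin_le_nhds
    refine mem_closure_of_tendsto ht ?_
    filter_upwards [self_mem_nhdsWithin] with s hs
    have hs : 0 < s := hs
    have : s * inner ℝ w w ≠ 0 := mul_ne_zero hs.ne' (inner_self_ne_zero.2 hw)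
    simp only [ne_eq, inner_add_left, real_inner_smul_left, hx]
    simpa using this
  · exact subset_closure hx

/-- A point of the alcove `A_v` from which the walls of `A_v` separating it from `y` are seen at
different times: the equation `(v_α + 1 - x_α) / (y_α - x_α) = (v_β + 1 - x_β) / (y_β - x_β)` is
linear in `x`. -/
theorem exists_generic_mem_alcove [Finite ι] [FiniteDimensional ℝ V] [P.IsReduced]
    (hP : IsEuclideanNormalized P) {b : P.Base} {v : PosRoot b → ℤ} (hv : (alcove b v).Nonempty)
    {y : V} (hy : y ∈ arrangementCompl b) :
    ∃ x ∈ alcove b v, ∀ a c : PosRoot b, a ≠ c →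
      (v a + 1 - inner ℝ x (P.coroot a)) * (inner ℝ y (P.coroot c) - inner ℝ x (P.coroot c)) ≠
      (v c + 1 - inner ℝ x (P.coroot c)) * (inner ℝ y (P.coroot a) - inner ℝ x (P.coroot a)) := by
  have := FiniteDimensional.complete ℝ V
  let w : PosRoot b × PosRoot b → V := fun r =>
    (v r.1 + 1 - inner ℝ y (P.coroot r.1)) • P.coroot r.2 +
      (inner ℝ y (P.coroot r.2) - (v r.2 + 1)) • P.coroot r.1
  let s : PosRoot b × PosRoot b → ℝ := fun r =>
    (v r.1 + 1) * inner ℝ y (P.coroot r.2) - (v r.2 + 1) * inner ℝ y (P.coroot r.1)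
  have hd : Dense (⋂ r, {x : V | r.1 ≠ r.2 → inner ℝ x (w r) ≠ s r}) := by
    refine dense_iInter_of_isOpen (fun r => ?_) (fun r => ?_)
    · by_cases h : r.1 = r.2
      · simp [h]
      · simp only [ne_eq, h, not_false_eq_true, forall_const]
        exact isOpen_ne_fun (by fun_prop) (by fun_prop)
    · by_cases h : r.1 = r.2
      · simp [h]
      · simp only [ne_eq, h, not_false_eq_true, forall_const]
        refine dense_inner_ne (fun h0 => ?_) _
        have := LinearIndependent.pair_iff.1 (linearIndependent_coroot_pair hP b h) _ _
          ((add_comm _ _).trans h0)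
        refine mem_arrangementCompl.1 hy r.1 (v r.1 + 1) ?_
        push_cast
        linarith [this.2]
  obtain ⟨x, hx, hx'⟩ := hd.inter_open_nonempty _ (isOpen_alcove b v) hv
  refine ⟨x, hx, fun a c hac heq => mem_iInter.1 hx' (a, c) hac ?_⟩
  simp only [w, s, inner_add_right, inner_smul_right]
  linear_combination -heq

/-- If every hyperplane separating two alcoves has the first one below it, then a generic segment
from the first to the second leaves the first one through a single wall. -/
theorem exists_isWallPoint_of_lt [Finite ι] [FiniteDimensional ℝ V] [P.IsReduced]
    (hP : IsEuclideanNormalized P) {b : P.Base} {v u : PosRoot b → ℤ}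
    (hv : (alcove b v).Nonempty) (hu : (alcove b u).Nonempty) (hlt : v < u) :
    ∃ a, v a < u a ∧ ∃ x ∈ alcove b v, ∃ y ∈ alcove b u, ∃ p ∈ segment ℝ x y,
      IsWallPoint b v a p := by
  classical
  obtain ⟨y, hy⟩ := hu
  obtain ⟨x, hx, hgen⟩ :=
    exists_generic_mem_alcove hP hv (alcove_subset_arrangementCompl b u hy)
  have hxa := mem_alcove.1 hx
  have hya := mem_alcove.1 hy
  obtain ⟨hle, a₀, ha₀⟩ := Pi.lt_def.1 hlt
  let t : PosRoot b → ℝ := fun a =>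
    (v a + 1 - inner ℝ x (P.coroot a)) / (inner ℝ y (P.coroot a) - inner ℝ x (P.coroot a))
  obtain ⟨a, ha, hmin⟩ := Finset.exists_min_image (Finset.univ.filter fun a => v a < u a) t
    ⟨a₀, by simpa using ha₀⟩
  simp only [Finset.mem_filter, Finset.mem_univ, true_and] at ha hmin
  have hstep : ∀ c, v c < u c → (v c : ℝ) + 1 ≤ u c := fun c hc => by exact_mod_cast hc
  have hden : ∀ c, v c < u c → 0 < inner ℝ y (P.coroot c) - inner ℝ x (P.coroot c) :=
    fun c hc => by linarith [(hxa c).2, (hya c).1, hstep c hc]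
  have htpos : 0 < t a := div_pos (by linarith [(hxa a).2]) (hden a ha)
  have htlt : t a < 1 := by
    rw [div_lt_one (hden a ha)]; linarith [(hya a).1, hstep a ha]
  refine ⟨a, ha, x, hx, y, hy, AffineMap.lineMap x y (t a), ?_, ?_, fun c hc => ?_⟩
  · rw [segment_eq_image_lineMap]
    exact mem_image_of_mem _ ⟨htpos.le, htlt.le⟩
  · rw [inner_lineMap, div_mul_cancel₀ _ (hden a ha).ne']; ring
  · rw [inner_lineMap]
    rcases (hle c).lt_or_eq with h | h
    · have hlt : t a < t c := lt_of_le_of_ne (hmin c h) fun he => hgen a c hc.symm (by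
        rwa [div_eq_div_iff (hden a ha).ne' (hden c h).ne'] at he)
      constructor
      · linarith [(hxa c).1, mul_pos htpos (hden c h)]
      · have := (lt_div_iff₀ (hden c h)).1 hlt
        linarith
    · have h1 := hxa c
      have h2 := hya c
      rw [← h] at h2
      constructor <;> nlinarith

theorem exists_isWallPoint_of_step {b : P.Base} {v u : PosRoot b → ℤ}
    (hv : (alcove b v).Nonempty) (hu : (alcove b u).Nonempty) {a : PosRoot b}
    (ha : u a = v a + 1) (hc : ∀ c, c ≠ a → u c = v c) : ∃ p, IsWallPoint b v a p := by
  obtain ⟨x, hx⟩ := hv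
  obtain ⟨y, hy⟩ := hu
  have hxa := mem_alcove.1 hx
  have hya := mem_alcove.1 hy
  have h1 := hxa a
  have h2 := hya a
  rw [ha] at h2
  push_cast at h2
  have hden : 0 < inner ℝ y (P.coroot a) - inner ℝ x (P.coroot a) := by linarith
  let t : ℝ :=
    (v a + 1 - inner ℝ x (P.coroot a)) / (inner ℝ y (P.coroot a) - inner ℝ x (P.coroot a))
  have htpos : 0 < t := div_pos (by linarith) hden
  have htlt : t < 1 := by rw [div_lt_one hden]; linarith
  refine ⟨AffineMap.lineMap x y t, ?_, fun c hca => ?_⟩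
  · rw [inner_lineMap, div_mul_cancel₀ _ hden.ne']; ring
  · rw [inner_lineMap]
    have h3 := hxa c
    have h4 := hya c
    rw [hc c hca] at h4
    constructor <;> nlinarith

/-- A neighbourhood of a wall point is contained in the union of the wall and the two alcoves
adjacent across it. -/
theorem IsWallPoint.eventually [Finite ι] {b : P.Base} {v : PosRoot b → ℤ} {a : PosRoot b} {p : V}
    (hp : IsWallPoint b v a p) :
    ∀ᶠ q in 𝓝 p, (∀ c, c ≠ a → (v c : ℝ) < inner ℝ q (P.coroot c) ∧
        inner ℝ q (P.coroot c) < v c + 1) ∧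
      (v a : ℝ) < inner ℝ q (P.coroot a) ∧ inner ℝ q (P.coroot a) < v a + 2 := by
  refine Filter.Eventually.and ?_ (Filter.Eventually.and ?_ ?_)
  · refine Filter.eventually_all.2 fun c => ?_
    by_cases hc : c = a
    · simp [hc]
    · have : ∀ᶠ q in 𝓝 p, q ∈ strip P c (v c) := (isOpen_strip P c (v c)).mem_nhds (hp.2 c hc)
      exact this.mono fun q hq _ => hq
  · exact (isOpen_lt (by fun_prop) (by fun_prop)).mem_nhds (by rw [mem_ofPred_eq, hp.1]; linarith)
  · exact (isOpen_lt (by fun_prop) (by fun_prop)).mem_nhds (by rw [mem_ofPred_eq, hp.1]; linarith)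

theorem inner_add_smul_root (hP : IsEuclideanNormalized P) (q : V) (s : ℝ) (i : ι) :
    inner ℝ (q + s • P.root i) (P.coroot i) = inner ℝ q (P.coroot i) + 2 * s := by
  rw [inner_add_left, real_inner_smul_left, ← hP.toLinearMap_eq (P.root i),
    P.root_coroot_eq_pairing, P.pairing_same, mul_comm]

theorem tendsto_add_smul (q w : V) : Tendsto (fun s : ℝ => q + s • w) (𝓝 0) (𝓝 q) := by
  have : Continuous fun s : ℝ => q + s • w := by fun_prop
  simpa using this.tendsto 0

section

variable [Finite ι] [FiniteDimensional ℝ V] [P.IsRootSystem] [P.IsCrystallographic]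
  [P.IsReduced] [P.IsIrreducible]

open Classical in
/-- Between two comparable admitted vectors there is always one obtained from the smaller one by a
unit step in one coordinate. -/
theorem exists_isAdmitted_update (hP : IsEuclideanNormalized P) {b : P.Base}
    {v u : PosRoot b → ℤ} (hv : IsAdmitted b v) (hu : IsAdmitted b u) (hlt : v < u) :
    ∃ a, v a < u a ∧ IsAdmitted b (Function.update v a (v a + 1)) := by
  obtain ⟨a, ha, x, hx, y, hy, p, hp, hwall⟩ :=
    exists_isWallPoint_of_lt hP (hv.2.alcove_nonempty hP) (hu.2.alcove_nonempty hP) hlt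
  refine ⟨a, ha, ?_⟩
  have hpf : p ∈ fundPolytope b := (convex_fundPolytope b).segment_subset
    (hv.1.alcove_subset hx) (hu.1.alcove_subset hy) hp
  -- a small push from the wall point in the direction of the root `α` leads into the next alcove
  have h1 := hwall.eventually.and ((isOpen_fundPolytope b).mem_nhds hpf)
  have h2 := ((tendsto_add_smul p (P.root a)).mono_left
    (nhdsWithin_le_nhds (s := Ioi (0 : ℝ)))).eventually h1
  obtain ⟨s, ⟨⟨hs1, -, hs2⟩, hs3⟩, hs0⟩ := (h2.and self_mem_nhdsWithin).exists
  have hs0 : 0 < s := hs0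
  have hmem : p + s • P.root a ∈ alcove b (Function.update v a (v a + 1)) := by
    refine mem_alcove.2 fun c => ?_
    by_cases hc : c = a
    · subst hc
      rw [Function.update_self]
      push_cast
      refine ⟨?_, by linarith⟩
      rw [inner_add_smul_root hP, hwall.1]
      linarith
    · rw [Function.update_of_ne hc]
      exact hs1 c hc
  exact ⟨isAdmissible_of_mem_alcove hP hmem hs3, shiSystem_of_mem_alcove hP hmem⟩

theorem covBy_iff (hP : IsEuclideanNormalized P) {b : P.Base} (lam gam : AdmittedVector b) :
    lam ⋖ gam ↔ ∃ a : PosRoot b,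
      gam.1 a = lam.1 a + 1 ∧ ∀ c : PosRoot b, c ≠ a → gam.1 c = lam.1 c := by
  classical
  constructor
  · intro h
    have hlt : lam.1 < gam.1 := h.lt
    obtain ⟨a, ha, hadm⟩ := exists_isAdmitted_update hP lam.2 gam.2 hlt
    have h1 : lam < ⟨_, hadm⟩ := by
      refine Subtype.mk_lt_mk.2 ?_
      exact lt_update_self_iff.2 (lt_add_one _)
    have h2 : (⟨_, hadm⟩ : AdmittedVector b) ≤ gam := by
      refine Subtype.mk_le_mk.2 ?_
      exact update_le_iff.2 ⟨ha, fun c _ => hlt.le c⟩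
    have h3 : (⟨_, hadm⟩ : AdmittedVector b) = gam := h2.eq_of_not_lt (h.2 h1)
    refine ⟨a, ?_, fun c hc => ?_⟩ <;> rw [← h3]
    · exact Function.update_self _ _ _
    · exact Function.update_of_ne hc _ _
  · rintro ⟨a, ha, hc⟩
    refine ⟨lt_of_le_of_ne (fun c => ?_) (fun h => ?_), fun m h1 h2 => ?_⟩
    · change lam.1 c ≤ gam.1 c
      by_cases h : c = a
      · subst h; omega
      · exact (hc c h).ge
    · have := congrFun (congrArg Subtype.val h) a
      omega
    · have hm : ∀ c, c ≠ a → m.1 c = lam.1 c := fun c h =>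
        le_antisymm ((h2.le c).trans (hc c h).le) (h1.le c)
      have hne1 : m.1 a ≠ lam.1 a := fun h => h1.ne (Subtype.ext (funext fun c => by
        by_cases hca : c = a
        · rw [hca, h]
        · rw [hm c hca]))
      have hne2 : m.1 a ≠ gam.1 a := fun h => h2.ne (Subtype.ext (funext fun c => by
        by_cases hca : c = a
        · rw [hca, h]
        · rw [hm c hca, hc c hca]))
      have h3 : lam.1 a ≤ m.1 a := h1.le a
      have h4 : m.1 a ≤ gam.1 a := h2.le a
      omega

end

/-! ### The action of a reflection on the components of the Shi variety -/

/-- The components of the Shi variety are the translates by admissible vectors of the image of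
the dual of `V` under evaluation at the positive coroots. -/
theorem mem_component_iff_exists_linearMap (b : P.Base) [P.IsRootSystem] {v : PosRoot b → ℤ}
    (hv : IsAdmissible b v) (x : PosRoot b → ℝ) :
    x ∈ component b v ↔ ∃ f : V →ₗ[ℝ] ℝ, ∀ θ : PosRoot b, x θ = f (P.coroot θ) + v θ := by
  rw [mem_component]
  have key : ∀ (f : V →ₗ[ℝ] ℝ) (w : V), f w =
      ∑ j : b.support, b.toCoweightBasis.repr w j * f (P.coroot j) := fun f w => by
    conv_lhs => rw [← b.toCoweightBasis.sum_repr w, map_sum]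
    simp
  constructor
  · intro h
    refine ⟨b.toCoweightBasis.constr ℝ fun j => x (simplePos b j), fun θ => ?_⟩
    rw [h θ, key]
    congr 1
    refine Finset.sum_congr rfl fun j _ => ?_
    rw [← b.toCoweightBasis_apply j, Module.Basis.constr_basis]
  · rintro ⟨f, hf⟩ θ
    rw [hf θ, key]
    congr 1
    refine Finset.sum_congr rfl fun j _ => ?_
    rw [hf (simplePos b j), hv.simple_eq_zero j]
    simp [simplePos]

theorem root_reflectionPerm_neg (i j : ι) :
    P.root (P.reflectionPerm i (P.reflectionPerm j j)) = -P.root (P.reflectionPerm i j) := by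
  rw [P.root_reflectionPerm, root_reflectionPerm_self, map_neg, ← P.root_reflectionPerm]

theorem reflection_root_eq_iff (i j k : ι) :
    P.reflection i (P.root j) = P.root k ↔ j = P.reflectionPerm i k := by
  rw [← P.root_reflectionPerm, P.root.injective.eq_iff]
  constructor <;> rintro rfl <;> rw [P.reflectionPerm_self]

section

variable [Finite ι]

theorem phiRep_of_isPos (b : P.Base) (a g : PosRoot b) (x : PosRoot b → ℝ)
    (h : b.IsPos (P.reflectionPerm a g)) : phiRep b a 0 x g = x ⟨P.reflectionPerm a g, h⟩ := by
  classical
  rw [phiRep, Pi.add_apply, reflShift, if_pos h, Matrix.mulVec, dotProduct,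
    Finset.sum_eq_single ⟨P.reflectionPerm a g, h⟩]
  · simp [reflMatrix]
  · intro i _ hi
    rw [reflMatrix, if_neg, if_neg, zero_mul]
    · rw [← root_reflectionPerm_self, reflection_root_eq_iff]
      intro hi'
      have hneg : (i : ι) = P.reflectionPerm (P.reflectionPerm a g) (P.reflectionPerm a g) := by
        refine eq_reflectionPerm_self ?_
        rw [hi', root_reflectionPerm_neg]
      have := i.2
      rw [hneg, isPos_neg_iff] at this
      exact this h
    · rw [reflection_root_eq_iff]
      exact fun h' => hi (Subtype.ext h')
  · simp

theorem phiRep_of_not_isPos (b : P.Base) (a g : PosRoot b) (x : PosRoot b → ℝ)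
    (h : ¬ b.IsPos (P.reflectionPerm a g)) :
    phiRep b a 0 x g = -x ⟨P.reflectionPerm (P.reflectionPerm a g) (P.reflectionPerm a g),
      (isPos_neg_iff b _).2 h⟩ - 1 := by
  classical
  have hneg : ∀ i : ι, P.reflection a (P.root i) = -P.root g ↔
      i = P.reflectionPerm (P.reflectionPerm a g) (P.reflectionPerm a g) := fun i => by
    rw [← root_reflectionPerm_self, reflection_root_eq_iff]
    refine Eq.congr_right (P.root.injective ?_)
    rw [root_reflectionPerm_self, root_reflectionPerm_neg]
  have hpos : ∀ i : PosRoot b, P.reflection a (P.root i) ≠ P.root g := fun i hi => by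
    rw [reflection_root_eq_iff] at hi
    exact h (hi ▸ i.2)
  rw [phiRep, Pi.add_apply, reflShift, if_neg h, Matrix.mulVec, dotProduct,
    Finset.sum_eq_single ⟨P.reflectionPerm (P.reflectionPerm a g) (P.reflectionPerm a g),
      (isPos_neg_iff b _).2 h⟩]
  · rw [reflMatrix, if_neg (hpos _), if_pos ((hneg _).2 rfl)]
    simp
    ring
  · intro i _ hi
    rw [reflMatrix, if_neg (hpos i), if_neg, zero_mul]
    rw [hneg]
    exact fun h' => hi (Subtype.ext h')
  · simp

/-- The linear part of `F(s_α)` is the action of `s_α` on evaluations at coroots. -/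
theorem phiRep_add (b : P.Base) (a : PosRoot b) (f : V →ₗ[ℝ] ℝ) (y : PosRoot b → ℝ)
    (g : PosRoot b) : phiRep b a 0 (fun θ => f (P.coroot θ) + y θ) g =
      f (P.coroot (P.reflectionPerm a g)) + phiRep b a 0 y g := by
  by_cases h : b.IsPos (P.reflectionPerm a g)
  · rw [phiRep_of_isPos b a g _ h, phiRep_of_isPos b a g _ h]
  · rw [phiRep_of_not_isPos b a g _ h, phiRep_of_not_isPos b a g _ h]
    simp only
    rw [coroot_reflectionPerm_self, map_neg]
    ring

/-- The reflection in the wall `H_{α,k}`, `k = v_α + 1`, exchanges the alcoves `A_v` and `A_u`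
adjacent across it. It is `s_α` followed by the translation by `k α`, whence the formula: the
address of `s_α A_v` is `F(s_α) v`. Both alcoves are recognized at a point `p` of their common
wall, which the reflection fixes. -/
theorem IsWallPoint.phiRep_eq [P.IsCrystallographic] [P.IsReduced] {b : P.Base}
    {v u : PosRoot b → ℤ} {a : PosRoot b} {p : V}
    (hp : IsWallPoint b v a p) (ha : u a = v a + 1) (hc : ∀ c, c ≠ a → u c = v c)
    (θ : PosRoot b) :
    (u θ : ℝ) = phiRep b a 0 (fun c => (v c : ℝ)) θ + (v a + 1) * P.pairing a θ := by
  have hz : ((P.pairingIn ℤ a θ : ℤ) : ℝ) = P.pairing a θ := by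
    rw [← P.algebraMap_pairingIn ℤ, algebraMap_int_eq, eq_intCast]
  have hin : inner ℝ p (P.coroot (P.reflectionPerm a θ)) =
      inner ℝ p (P.coroot θ) - (v a + 1) * P.pairing a θ := by
    rw [P.coroot_reflectionPerm, P.coreflection_apply_coroot, inner_sub_right, inner_smul_right,
      hp.1, mul_comm]
  by_cases hθ : θ = a
  · subst hθ
    have hn : ¬ b.IsPos (P.reflectionPerm θ θ) := by rw [isPos_neg_iff]; exact not_not.2 θ.2
    rw [phiRep_of_not_isPos b θ θ _ hn, P.pairing_same, ha]
    simp only [reflectionPerm_self_self]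
    push_cast
    ring
  rw [hc θ hθ, ← hz]
  rw [← hz] at hin
  have h1 := hp.2 θ hθ
  by_cases h : b.IsPos (P.reflectionPerm a θ)
  · rw [phiRep_of_isPos b a θ _ h]
    have hne : (⟨P.reflectionPerm a θ, h⟩ : PosRoot b) ≠ a := fun he => by
      have he' : (θ : ι) = P.reflectionPerm a a := by
        rw [← P.reflectionPerm_self a θ, show P.reflectionPerm a θ = (a : ι) from
          congrArg Subtype.val he]
      have := θ.2
      rw [he', isPos_neg_iff] at this
      exact this a.2
    have h2 := hp.2 _ hne
    simp only at h2
    rw [hin] at h2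
    generalize v ⟨P.reflectionPerm a θ, h⟩ = m at *
    generalize P.pairingIn ℤ a θ = n at *
    have h3 : (v θ : ℝ) < ((m + (v a + 1) * n + 1 : ℤ) : ℝ) := by push_cast; linarith
    have h4 : ((m + (v a + 1) * n : ℤ) : ℝ) < ((v θ + 1 : ℤ) : ℝ) := by push_cast; linarith
    have h3 := Int.cast_lt.1 h3
    have h4 := Int.cast_lt.1 h4
    have : v θ = m + (v a + 1) * n := by omega
    rw [this]; push_cast; ring
  · rw [phiRep_of_not_isPos b a θ _ h]
    have hne : (⟨P.reflectionPerm (P.reflectionPerm a θ) (P.reflectionPerm a θ),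
        (isPos_neg_iff b _).2 h⟩ : PosRoot b) ≠ a := fun he => by
      refine hθ (Subtype.ext (P.root.injective ?_))
      have h5 : -P.root (P.reflectionPerm a θ) = P.root a := by
        rw [← root_reflectionPerm_self]
        exact congrArg P.root (congrArg Subtype.val he)
      rw [← P.reflectionPerm_self a θ, P.root_reflectionPerm, neg_eq_iff_eq_neg.1 h5, map_neg,
        P.reflection_apply_self, neg_neg]
    have h2 := hp.2 _ hne
    simp only at h2
    rw [coroot_reflectionPerm_self, inner_neg_right, hin] at h2
    generalize v ⟨P.reflectionPerm (P.reflectionPerm a θ) (P.reflectionPerm a θ), _⟩ = m at *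
    generalize P.pairingIn ℤ a θ = n at *
    have h3 : (v θ : ℝ) < ((-m + (v a + 1) * n : ℤ) : ℝ) := by push_cast; linarith
    have h4 : ((-m - 1 + (v a + 1) * n : ℤ) : ℝ) < ((v θ + 1 : ℤ) : ℝ) := by push_cast; linarith
    have h3 := Int.cast_lt.1 h3
    have h4 := Int.cast_lt.1 h4
    have : v θ = -m - 1 + (v a + 1) * n := by omega
    rw [this]; push_cast; ring

theorem IsWallPoint.diamondEq [P.IsRootSystem] [P.IsCrystallographic] [P.IsReduced] {b : P.Base}
    {v u : PosRoot b → ℤ} (hv : IsAdmissible b v) (hu : IsAdmissible b u) {a : PosRoot b} {p : V}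
    (hp : IsWallPoint b v a p) (ha : u a = v a + 1) (hc : ∀ c, c ≠ a → u c = v c) :
    DiamondEq b a 0 v u := by
  have key : ∀ (f : V →ₗ[ℝ] ℝ) (θ : PosRoot b),
      phiRep b a 0 (fun θ => f (P.coroot θ) + v θ) θ =
        f (P.coroot θ) - P.pairing a θ * (f (P.coroot a) + (v a + 1)) + u θ := fun f θ => by
    rw [phiRep_add, hp.phiRep_eq ha hc θ, P.coroot_reflectionPerm, P.coreflection_apply_coroot,
      map_sub, map_smul, smul_eq_mul]
    ring
  refine Subset.antisymm ?_ fun y hy => ?_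
  · rintro _ ⟨x, hx, rfl⟩
    obtain ⟨f, hf⟩ := (mem_component_iff_exists_linearMap b hv x).1 hx
    refine (mem_component_iff_exists_linearMap b hu _).2
      ⟨f - (f (P.coroot a) + (v a + 1)) • P.toLinearMap (P.root a), fun θ => ?_⟩
    rw [show x = fun θ : PosRoot b => f (P.coroot θ) + v θ from funext hf, key, LinearMap.sub_apply,
      LinearMap.smul_apply, P.root_coroot_eq_pairing, smul_eq_mul]
    ring
  · obtain ⟨f, hf⟩ := (mem_component_iff_exists_linearMap b hu y).1 hy
    -- the dual of the reflection in the wall is an involution, which gives the preimage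
    let f' : V →ₗ[ℝ] ℝ := f - (f (P.coroot a) + (v a + 1)) • P.toLinearMap (P.root a)
    have hf' : ∀ i, f' (P.coroot i) =
        f (P.coroot i) - (f (P.coroot a) + (v a + 1)) * P.pairing a i := fun i => by
      simp only [f', LinearMap.sub_apply, LinearMap.smul_apply, P.root_coroot_eq_pairing,
        smul_eq_mul]
    refine ⟨fun θ : PosRoot b => f' (P.coroot θ) + v θ,
      (mem_component_iff_exists_linearMap b hv _).2 ⟨f', fun θ => rfl⟩, funext fun θ => ?_⟩
    rw [key, hf', hf', hf, P.pairing_same]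
    ring

end

/-! ### Adjacency of alcoves -/

theorem mem_closure_alcove {b : P.Base} {v : PosRoot b → ℤ} {x : V}
    (hx : x ∈ closure (alcove b v)) (a : PosRoot b) :
    (v a : ℝ) ≤ inner ℝ x (P.coroot a) ∧ inner ℝ x (P.coroot a) ≤ v a + 1 := by
  have hcont : Continuous fun x : V => (inner ℝ x (P.coroot a) : ℝ) := by fun_prop
  have hcl : IsClosed {x : V | (v a : ℝ) ≤ inner ℝ x (P.coroot a) ∧
      inner ℝ x (P.coroot a) ≤ v a + 1} :=
    (isClosed_le continuous_const hcont).inter (isClosed_le hcont continuous_const)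
  have hsub : closure (alcove b v) ⊆ {x : V | (v a : ℝ) ≤ inner ℝ x (P.coroot a) ∧
      inner ℝ x (P.coroot a) ≤ v a + 1} := closure_minimal (fun y hy => by
    have h := mem_alcove.1 hy a
    exact ⟨h.1.le, h.2.le⟩) hcl
  exact hsub hx

/-- The hyperplane `H_{α,k}`, as an affine subspace. -/
def affineHyperplane (P : RootPairing ι ℝ V V) (i : ι) (k : ℤ) : AffineSubspace ℝ V where
  carrier := hyperplane P i k
  smul_vsub_vadd_mem' c x y z hx hy hz := by
    change inner ℝ x _ = _ at hx
    change inner ℝ y _ = _ at hy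
    change inner ℝ z _ = _ at hz
    change inner ℝ (c • (x - y) + z) _ = _
    rw [inner_add_left, real_inner_smul_left, inner_sub_left, hx, hy, hz, sub_self, mul_zero,
      zero_add]

theorem hyperplane_nonempty (hP : IsEuclideanNormalized P) (i : ι) (k : ℤ) :
    (hyperplane P i k).Nonempty := by
  refine ⟨0 + ((k : ℝ) / 2) • P.root i, ?_⟩
  change inner ℝ _ _ = _
  rw [inner_add_smul_root hP, inner_zero_left]
  ring

/-- The hyperplanes of distinct positive roots do not contain one another. -/
theorem not_hyperplane_subset [Finite ι] [P.IsReduced] (hP : IsEuclideanNormalized P) {b : P.Base}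
    {a c : PosRoot b} (hca : c ≠ a) (k l : ℤ) : ¬ hyperplane P a k ⊆ hyperplane P c l := by
  intro hsub
  obtain ⟨q, hq⟩ := hyperplane_nonempty hP (a : ι) k
  have hne : inner ℝ (P.coroot a) (P.coroot a) ≠ (0 : ℝ) := inner_self_ne_zero.2 (by
    intro h0
    have h1 := P.root_coroot_two (a : ι)
    rw [h0, map_zero] at h1
    norm_num at h1)
  -- the component of `γ^∨` orthogonal to `α^∨`
  let r : ℝ := inner ℝ (P.coroot c) (P.coroot a) / inner ℝ (P.coroot a) (P.coroot a)
  let d : V := P.coroot c - r • P.coroot a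
  have hda : inner ℝ d (P.coroot a) = 0 := by
    simp only [d, r]
    rw [inner_sub_left, real_inner_smul_left, div_mul_cancel₀ _ hne, sub_self]
  have hq' : q + d ∈ hyperplane P a k := by
    change inner ℝ _ _ = _
    rw [inner_add_left, hda, add_zero]
    exact hq
  have hdc : inner ℝ d (P.coroot c) = 0 := by
    have h1 : inner ℝ q (P.coroot c) = l := hsub hq
    have h2 : inner ℝ (q + d) (P.coroot c) = l := hsub hq'
    rw [inner_add_left, h1] at h2
    linarith
  have hd : d = 0 := by
    refine inner_self_eq_zero (𝕜 := ℝ).1 ?_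
    conv_lhs => rw [show inner ℝ d d = inner ℝ d (P.coroot c - r • P.coroot a) from rfl]
    rw [inner_sub_right, inner_smul_right, hdc, hda, mul_zero, sub_zero]
  have := LinearIndependent.pair_iff.1 (linearIndependent_coroot_pair hP b hca) 1 (-r) (by
    rw [one_smul, neg_smul, ← sub_eq_add_neg]; exact hd)
  exact one_ne_zero this.1

variable [Finite ι]

theorem IsWallPoint.mem_closure (hP : IsEuclideanNormalized P) {b : P.Base}
    {v u : PosRoot b → ℤ} {a : PosRoot b} {p : V} (hp : IsWallPoint b v a p)
    (ha : u a = v a + 1) (hc : ∀ c, c ≠ a → u c = v c) :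
    p ∈ closure (alcove b v) ∩ closure (alcove b u) := by
  have ht := (tendsto_add_smul p (P.root a)).eventually hp.eventually
  constructor
  · refine mem_closure_of_tendsto ((tendsto_add_smul p (P.root a)).mono_left
      (nhdsWithin_le_nhds (s := Iio (0 : ℝ)))) ?_
    filter_upwards [ht.filter_mono nhdsWithin_le_nhds, self_mem_nhdsWithin] with s h1 hs
    have hs : s < 0 := hs
    refine mem_alcove.2 fun c => ?_
    by_cases hca : c = a
    · subst hca
      refine ⟨h1.2.1, ?_⟩
      rw [inner_add_smul_root hP, hp.1]; linarith
    · exact h1.1 c hca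
  · refine mem_closure_of_tendsto ((tendsto_add_smul p (P.root a)).mono_left
      (nhdsWithin_le_nhds (s := Ioi (0 : ℝ)))) ?_
    filter_upwards [ht.filter_mono nhdsWithin_le_nhds, self_mem_nhdsWithin] with s h1 hs
    have hs : 0 < s := hs
    refine mem_alcove.2 fun c => ?_
    by_cases hca : c = a
    · subst hca
      rw [ha]
      push_cast
      refine ⟨?_, by linarith [h1.2.2]⟩
      rw [inner_add_smul_root hP, hp.1]; linarith
    · rw [hc c hca]
      exact h1.1 c hca

/-- The wall points of a given wall are open in its hyperplane, so that they span it. -/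
theorem IsWallPoint.adjacentAcross (hP : IsEuclideanNormalized P) {b : P.Base}
    {v u : PosRoot b → ℤ} {a : PosRoot b} {p : V} (hp : IsWallPoint b v a p)
    (ha : u a = v a + 1) (hc : ∀ c, c ≠ a → u c = v c) :
    AdjacentAcross P (alcove b v) (alcove b u) a (v a + 1) := by
  refine ⟨Subset.antisymm ?_ fun z hz => ?_, fun x hx => ?_, fun x hx => ?_⟩
  · have : affineSpan ℝ (closure (alcove b v) ∩ closure (alcove b u)) ≤
        affineHyperplane P a (v a + 1) := by
      refine affineSpan_le.2 fun x hx => ?_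
      have h1 := (mem_closure_alcove hx.1 a).2
      have h2 := (mem_closure_alcove hx.2 a).1
      rw [ha] at h2
      change inner ℝ x _ = _
      push_cast at h2 ⊢
      exact le_antisymm h1 h2
    exact this
  · have hz' : inner ℝ z (P.coroot a) = v a + 1 := by
      have : inner ℝ z (P.coroot a) = ((v a + 1 : ℤ) : ℝ) := hz
      simpa using this
    -- `z` is on the line through the wall points `p` and `p + s • (z - p)`, for small `s > 0`
    have ht := ((tendsto_add_smul p (z - p)).eventually hp.eventually).filter_mono
      (nhdsWithin_le_nhds (s := Ioi (0 : ℝ)))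
    obtain ⟨s, h1, hs⟩ := (ht.and self_mem_nhdsWithin).exists
    have hs : 0 < s := hs
    have hq : IsWallPoint b v a (p + s • (z - p)) := by
      refine ⟨?_, h1.1⟩
      rw [inner_add_left, real_inner_smul_left, inner_sub_left, hz', hp.1]
      ring
    have hmem := AffineMap.lineMap_mem s⁻¹
      (subset_affineSpan ℝ _ (hp.mem_closure hP ha hc))
      (subset_affineSpan ℝ _ (hq.mem_closure hP ha hc))
    rwa [AffineMap.lineMap_apply, vsub_eq_sub, vadd_eq_add, add_sub_cancel_left,
      inv_smul_smul₀ hs.ne', sub_add_cancel] at hmem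
  · have := (mem_alcove.1 hx a).2
    change inner ℝ x _ < _
    push_cast
    exact this
  · have := (mem_alcove.1 hx a).1
    rw [ha] at this
    exact this

theorem AdjacentAcross.step [P.IsReduced] (hP : IsEuclideanNormalized P) {b : P.Base}
    {v u : PosRoot b → ℤ} (hv : (alcove b v).Nonempty) (hu : (alcove b u).Nonempty)
    {a : PosRoot b} {k : ℤ} (h : AdjacentAcross P (alcove b v) (alcove b u) a k) :
    u a = v a + 1 ∧ ∀ c, c ≠ a → u c = v c := by
  obtain ⟨hspan, hlo, hhi⟩ := h
  obtain ⟨x, hx⟩ := hv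
  obtain ⟨y, hy⟩ := hu
  have h1 : (v a : ℝ) < k := (mem_alcove.1 hx a).1.trans (hlo hx)
  have h2 : (k : ℝ) < u a + 1 := lt_trans (hhi hy) (mem_alcove.1 hy a).2
  have h1 : v a < k := by exact_mod_cast h1
  have h2 : k < u a + 1 := by exact_mod_cast h2
  obtain ⟨q, hq⟩ : (closure (alcove b v) ∩ closure (alcove b u)).Nonempty := by
    rw [← affineSpan_nonempty ℝ, hspan]
    exact hyperplane_nonempty hP a k
  have h3 : (u a : ℝ) ≤ v a + 1 :=
    (mem_closure_alcove hq.2 a).1.trans (mem_closure_alcove hq.1 a).2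
  have h3 : u a ≤ v a + 1 := by exact_mod_cast h3
  refine ⟨by omega, fun c hca => ?_⟩
  -- another separating hyperplane would contain the common facet, hence its affine span
  have key : ∀ l : ℤ, ¬ (closure (alcove b v) ∩ closure (alcove b u) ⊆ hyperplane P c l) := by
    intro l hl
    refine not_hyperplane_subset hP hca k l ?_
    rw [← hspan]
    exact affineSpan_le (Q := affineHyperplane P c l).2 hl
  by_contra hne
  rcases lt_or_gt_of_ne hne with hlt | hlt
  · refine key (v c) fun z hz => le_antisymm ?_ (mem_closure_alcove hz.1 c).1
    have h4 := (mem_closure_alcove hz.2 c).2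
    have h5 : (u c : ℝ) + 1 ≤ v c := by exact_mod_cast hlt
    exact h4.trans h5
  · refine key (u c) fun z hz => le_antisymm ?_ (mem_closure_alcove hz.2 c).1
    have h4 := (mem_closure_alcove hz.1 c).2
    have h5 : (v c : ℝ) + 1 ≤ u c := by exact_mod_cast hlt
    exact h4.trans h5

end ShiVariety

theorem mainTheorem2 {ι V : Type*} [Finite ι] [NormedAddCommGroup V] [InnerProductSpace ℝ V]
    [FiniteDimensional ℝ V] (P : RootPairing ι ℝ V V) [P.IsRootSystem] [P.IsCrystallographic]
    [P.IsReduced] [P.IsIrreducible] (hP : IsEuclideanNormalized P) (b : P.Base)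
    (lam gam : AdmittedVector b) :
    (lam ⋖ gam ↔
      ∃! a : PosRoot b, DiamondEq b a 0 lam.1 gam.1 ∧
        gam.1 a = lam.1 a + 1 ∧ ∀ c : PosRoot b, c ≠ a → gam.1 c = lam.1 c) ∧
    BijOn (fun v : AdmittedVector b => alcove b v.1) univ
      {A | IsAlcove b A ∧ A ⊆ fundPolytope b} ∧
    (lam ⋖ gam ↔
      ∃ (a : PosRoot b) (k : ℤ),
        AdjacentAcross P (alcove b lam.1) (alcove b gam.1) a k) := by
  have hlam := lam.2.2.alcove_nonempty hP
  have hgam := gam.2.2.alcove_nonempty hP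
  refine ⟨?_, bijOn_alcove hP b, ?_⟩ <;> rw [covBy_iff hP lam gam]
  · constructor
    · rintro ⟨a, ha, hc⟩
      obtain ⟨p, hp⟩ := exists_isWallPoint_of_step hlam hgam ha hc
      refine ⟨a, ⟨hp.diamondEq lam.2.1 gam.2.1 ha hc, ha, hc⟩, fun a' ⟨_, ha', _⟩ => ?_⟩
      by_contra hne
      have := hc a' hne
      omega
    · rintro ⟨a, ⟨-, ha, hc⟩, -⟩
      exact ⟨a, ha, hc⟩
  · constructor
    · rintro ⟨a, ha, hc⟩
      obtain ⟨p, hp⟩ := exists_isWallPoint_of_step hlam hgam ha hc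
      exact ⟨a, _, hp.adjacentAcross hP ha hc⟩
    · rintro ⟨a, k, h⟩
      exact ⟨a, h.step hP hlam hgam⟩
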